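/- Let $g:[0,\infty)\to[0,1]$ be non-increasing with $0<C<\infty$, where $C=\int_{\mathbb{R}^2}g(\|x\|)\,dx$, and $g(x)=o\!\left(\frac{1}{x^2\log^2 x}\right)$ as $x\to\infty$. Let $b\in\mathbb{R}$ be a constant and, for $\rho>0$ with $\log\rho+b>0$, let $r_\rho=\sqrt{\frac{\log\rho+b}{C\rho}}$. Let the nodes form a homogeneous Poisson point process of density $\rho$ on the unit square $A=[-\tfrac12,\tfrac12)^2$. For $x,y\in A$ let $\|x-y\|$ be the Euclidean distance and $\|x-y\|^T=\min_{z\in\mathbb{Z}^2}\|x+z-y\|$ the toroidal distance. In the network on the torus, each pair of nodes, at positions $x$ and $y$ say, is directly connected with probability $g(\|x-y\|^T/r_\rho)$, independently over pairs. The network on the square, in which each pair of nodes is directly connected with probability $g(\|x-y\|/r_\rho)$ independently over pairs, is obtained from it by removing each connection, independently, with probability $1-\frac{g(\|x-y\|/r_\rho)}{g(\|x-y\|^T/r_\rho)}$. Let $W^E=W^E(\rho)$ be the number of isolated nodes due to the boundary effect, i.e. the number of nodes that are isolated in the network on the square but not in the network on the torus. Then $W^E$ is a.a.s. $0$ as $\rho\to\infty$,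 that is, $$\lim_{\rho\to\infty}\Pr\left(W^E=0\right)=1.$$ -/

import Mathlib

open MeasureTheory ProbabilityTheory Filter Topology Asymptotics
open scoped NNReal unitInterval

noncomputable section

namespace RandomConnection

/-- The Euclidean plane. -/
abbrev Plane : Type := EuclideanSpace ℝ (Fin 2)

/-- The half-open unit square `[-1/2, 1/2)²`. -/
def unitSquare : Set Plane := {x | ∀ k, x k ∈ Set.Ico (-1 / 2 : ℝ) (1 / 2)}

/-- The toroidal distance: the least Euclidean norm of `x + z - y` with `z ∈ ℤ²`
(the infimum is attained, since only finitely many `z` give a norm below a given bound). -/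
def torusDist (x y : Plane) : ℝ :=
  ⨅ z : Fin 2 → ℤ, ‖x + WithLp.toLp 2 (fun k => (z k : ℝ)) - y‖

/-- The standing conditions on the connection function `g : [0, ∞) → [0, 1]`
(the values of `g` at negative numbers play no role). -/
structure IsConnectionFunction (g : ℝ → ℝ) : Prop where
  mem_Icc : ∀ x, 0 ≤ x → g x ∈ Set.Icc (0 : ℝ) 1
  antitoneOn : AntitoneOn g (Set.Ici 0)
  integrable : Integrable (fun x : Plane => g ‖x‖)
  integral_pos : 0 < ∫ x : Plane, g ‖x‖
  isLittleO : g =o[atTop] fun x : ℝ => 1 / (x ^ 2 * Real.log x ^ 2)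

/-- The scale `r_ρ = √((log ρ + b) / (C ρ))` with `C = ∫_{ℝ²} g(‖x‖) dx`. -/
def scale (g : ℝ → ℝ) (b ρ : ℝ) : ℝ :=
  Real.sqrt ((Real.log ρ + b) / ((∫ x : Plane, g ‖x‖) * ρ))

/-- The sample space. A sample consists of a number of nodes `n`, a sequence of positions (the
nodes are `0, …, n - 1`, the other positions are not used), and two families of marks in `[0, 1]`
indexed by unordered pairs: the first decides which pairs are connected on the torus, the second
which of these connections are removed. -/
abbrev Sample : Type := ℕ × (ℕ → Plane) × (Sym2 ℕ → I) × (Sym2 ℕ → I)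

/-- The law of the sample: the nodes form a homogeneous Poisson point process of density `ρ` on the
unit square (a Poisson number, of mean `ρ` times the unit area, of independent uniform points), and
all marks are uniform on `[0, 1]`; everything is independent. -/
def sampleLaw (ρ : ℝ≥0) : Measure Sample :=
  (poissonMeasure ρ).prod
    ((Measure.infinitePi fun _ : ℕ => (volume : Measure Plane).restrict unitSquare).prod
      ((Measure.infinitePi fun _ : Sym2 ℕ => (volume : Measure I)).prod
        (Measure.infinitePi fun _ : Sym2 ℕ => (volume : Measure I))))

theorem volume_unitSquare : (volume : Measure Plane) unitSquare = 1 := by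
  have h : unitSquare = (WithLp.ofLp : Plane → Fin 2 → ℝ) ⁻¹'
      (Set.pi Set.univ fun _ => Set.Ico (-1 / 2 : ℝ) (1 / 2)) := by
    ext x
    simp [unitSquare]
  rw [h, (PiLp.volume_preserving_ofLp (Fin 2)).measure_preimage
    (MeasurableSet.univ_pi fun _ => measurableSet_Ico).nullMeasurableSet, Real.volume_pi_Ico]
  norm_num

/-- The position law is a probability measure, so that the product measures in `sampleLaw` are
genuine. -/
instance : IsProbabilityMeasure ((volume : Measure Plane).restrict unitSquare) :=
  ⟨by rw [Measure.restrict_apply_univ, volume_unitSquare]⟩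

instance (ρ : ℝ≥0) : IsProbabilityMeasure (sampleLaw ρ) := by
  unfold sampleLaw
  infer_instance

theorem torusDist_comm (x y : Plane) : torusDist x y = torusDist y x := by
  unfold torusDist
  refine (Equiv.neg (Fin 2 → ℤ)).iInf_congr fun z => ?_
  rw [← norm_neg]
  congr 1
  ext k
  simp
  ring

/-- The network on the torus: distinct nodes at positions `x`, `y` are connected with probability
`g (‖x - y‖ᵀ / r)`, independently over pairs. -/
def torusGraph (g : ℝ → ℝ) (r : ℝ) (ω : Sample) : SimpleGraph (Fin ω.1) where
  Adj i j := i ≠ j ∧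
    (ω.2.2.1 s(↑i, ↑j) : ℝ) < g (torusDist (ω.2.1 i) (ω.2.1 j) / r)
  symm := ⟨fun i j h => ⟨h.1.symm, by rw [Sym2.eq_swap, torusDist_comm]; exact h.2⟩⟩
  loopless := ⟨fun _ h => h.1 rfl⟩

/-- The connection between two nodes at positions `x`, `y`, if present on the torus, is removed with
probability `1 - g (‖x - y‖ / r) / g (‖x - y‖ᵀ / r)`, independently over pairs. -/
def Removed (g : ℝ → ℝ) (r : ℝ) (ω : Sample) (i j : Fin ω.1) : Prop :=
  (ω.2.2.2 s(↑i, ↑j) : ℝ) <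
    1 - g (‖ω.2.1 i - ω.2.1 j‖ / r) / g (torusDist (ω.2.1 i) (ω.2.1 j) / r)

/-- The network on the square, obtained from the network on the torus by the removal of connections.
Distinct nodes at positions `x`, `y` are connected with probability `g (‖x - y‖ / r)`. -/
def squareGraph (g : ℝ → ℝ) (r : ℝ) (ω : Sample) : SimpleGraph (Fin ω.1) where
  Adj i j := (torusGraph g r ω).Adj i j ∧ ¬ Removed g r ω i j
  symm := ⟨fun i j h => ⟨h.1.symm, by
    have h2 := h.2
    unfold Removed at h2 ⊢
    rwa [Sym2.eq_swap, torusDist_comm, norm_sub_rev]⟩⟩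
  loopless := ⟨fun i h => (torusGraph g r ω).loopless.irrefl i h.1⟩

/-- The number of isolated nodes due to the boundary effect: the nodes that are isolated in the
network on the square and were not isolated in the network on the torus. -/
def boundaryIsolatedCount (g : ℝ → ℝ) (r : ℝ) (ω : Sample) : ℕ :=
  {i : Fin ω.1 | (squareGraph g r ω).IsIsolated i ∧ ¬ (torusGraph g r ω).IsIsolated i}.ncard

end RandomConnection

end

noncomputable section

namespace RandomConnection

/-! ### Finite families of independent coordinates -/

/-! The proof is a first moment bound. A node at `x` is joined to a given other node with
probability `squareProb` or `torusProb`, call these `p_S(x)` and `p_T(x)`. Poisson size-biasing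
bounds `Pr(W^E ≠ 0)` by the integral over the square of `ρ (exp(-ρ p_S) - exp(-ρ p_T))`
(`sampleLaw_boundaryIsolatedCount_ne_zero_le`).

Put `l = log ρ` and `μ = ρ r² = (l + b) / C`. Wrapping the plane onto the torus gives `ρ p_T ≤ l +
b`, so the subtracted term is at least `e^{-b}`. Discarding four half-planes gives `ρ p_S ≥ l + b -
μ (side₀ + side₁)`, where `sideₖ` depends on the `k`-th coordinate only. The bound thus factorizes
into `e^{-b} (I₀ I₁ - 1)` with `Iₖ = ∫ exp(μ sideₖ)`; corners need no separate treatment. It remains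
to show `Iₖ → 1` (`tendsto_integral_exp_sideMass`).

Let `H` be `halfPlaneMass`, and consider a point at distance `u` from a side. Beyond `δ = ρ^{-1/4}`
the decay of `g` gives `H(t) log t → 0`, hence `μ H(u / r) → 0` uniformly. Within `δ`, either `H ≤ C
/ 10`, and the integrand, of order `ρ^{1/10}`, is beaten by the width `δ`; or `H(t) ≤ C / 2 - c t`,
and the integral is at most `e^{(l + b) / 2} r / (c μ)`, of order `(log ρ)^{-1/2}`. -/

theorem measurePreserving_comp_infinitePi {ι κ X : Type*} [Fintype κ] [MeasurableSpace X]
    (μ : Measure X) [IsProbabilityMeasure μ] {f : κ → ι} (hf : Function.Injective f) :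
    MeasurePreserving (fun (x : ι → X) (k : κ) => x (f k))
      (Measure.infinitePi fun _ : ι => μ) (Measure.pi fun _ : κ => μ) := by
  classical
  have hm : Measurable fun (x : ι → X) (k : κ) => x (f k) := by fun_prop
  refine ⟨hm, (Measure.pi_eq fun s hs => ?_).symm⟩
  rw [Measure.map_apply hm (MeasurableSet.univ_pi hs)]
  -- `Function.invFun`, which recovers an index from its coordinate below, needs a nonempty `κ`.
  cases isEmpty_or_nonempty κ
  · have h : (fun (x : ι → X) (k : κ) => x (f k)) ⁻¹' Set.univ.pi s = Set.univ := by
      ext x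
      simp
    rw [h]
    simp
  have h : (fun (x : ι → X) (k : κ) => x (f k)) ⁻¹' Set.univ.pi s =
      Set.pi (Finset.univ.image f : Finset ι) fun i => s (Function.invFun f i) := by
    ext x
    simp [Set.mem_pi, Function.leftInverse_invFun hf _]
  rw [h, Measure.infinitePi_pi _ fun i _ => hs _, Finset.prod_image hf.injOn]
  simp [Function.leftInverse_invFun hf _]

/-- The law of the position of a node together with the two marks of a pair. -/
def nodeLaw : Measure (Plane × I × I) :=
  ((volume : Measure Plane).restrict unitSquare).prod ((volume : Measure I).prod volume)

instance : IsProbabilityMeasure nodeLaw := by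
  unfold nodeLaw
  infer_instance

/-- The law of the positions and the marks. -/
def configLaw : Measure ((ℕ → Plane) × (Sym2 ℕ → I) × (Sym2 ℕ → I)) :=
  (Measure.infinitePi fun _ : ℕ => (volume : Measure Plane).restrict unitSquare).prod
      ((Measure.infinitePi fun _ : Sym2 ℕ => (volume : Measure I)).prod
        (Measure.infinitePi fun _ : Sym2 ℕ => (volume : Measure I)))

instance : IsProbabilityMeasure configLaw := by
  unfold configLaw
  infer_instance

/-- What a node `i` sees of the nodes `0, …, n`: their positions and the marks of the pairs that
they form with `i`. -/
def viewFrom {n : ℕ} (i : Fin (n + 1)) (ω : (ℕ → Plane) × (Sym2 ℕ → I) × (Sym2 ℕ → I))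
    (j : Fin (n + 1)) : Plane × I × I :=
  (ω.1 j, ω.2.1 s(↑i, ↑j), ω.2.2 s(↑i, ↑j))

/-- With `i` fixed, distinct `j` give distinct pairs, so the marks seen from `i` are independent.
The diagonal pair at `j = i` is kept only so that the view is a full product. -/
theorem measurePreserving_viewFrom {n : ℕ} (i : Fin (n + 1)) :
    MeasurePreserving (viewFrom i) configLaw (Measure.pi fun _ => nodeLaw) := by
  have hinj : Function.Injective fun j : Fin (n + 1) => s((i : ℕ), (j : ℕ)) := by
    intro j k h
    exact Fin.ext (Sym2.congr_right.1 h)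
  have h1 := measurePreserving_comp_infinitePi ((volume : Measure Plane).restrict unitSquare)
    (Fin.val_injective (n := n + 1))
  have h2 := measurePreserving_comp_infinitePi (volume : Measure I) hinj
  have h3 := (measurePreserving_arrowProdEquivProdArrow I I (Fin (n + 1))
    (fun _ => volume) (fun _ => volume)).symm
  have h4 := (measurePreserving_arrowProdEquivProdArrow Plane (I × I) (Fin (n + 1))
    (fun _ => (volume : Measure Plane).restrict unitSquare)
    (fun _ => (volume : Measure I).prod volume)).symm
  exact h4.comp (h1.prod (h3.comp (h2.prod h2)))

theorem lintegral_nodeLaw_fst {f : Plane → ENNReal} (hf : Measurable f) :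
    ∫⁻ p, f p.1 ∂nodeLaw = ∫⁻ x in unitSquare, f x :=
  (measurePreserving_fst (μ := (volume : Measure Plane).restrict unitSquare)
    (ν := (volume : Measure I).prod volume)).lintegral_comp hf

/-- The configurations of a node and `n` other nodes in which all the others lie in the section
of `U` at the position of the first. -/
def allIn (n : ℕ) (U : Set (Plane × Plane × I × I)) :
    Set ((Plane × I × I) × (Fin n → Plane × I × I)) :=
  {p | ∀ j, (p.1.1, p.2 j) ∈ U}

theorem measurableSet_allIn (n : ℕ) {U : Set (Plane × Plane × I × I)} (hU : MeasurableSet U) :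
    MeasurableSet (allIn n U) := by
  have : allIn n U = ⋂ j, (fun p : (Plane × I × I) × (Fin n → Plane × I × I) =>
      (p.1.1, p.2 j)) ⁻¹' U := by
    ext p; simp [allIn]
  rw [this]
  exact MeasurableSet.iInter fun j => (by fun_prop : Measurable _) hU

/-- Given the position of the first node, the other nodes are independent, whence the `n`-th powers.
-/
theorem measure_allIn_section (n : ℕ) {S T : Set (Plane × Plane × I × I)}
    (hT : MeasurableSet T) (hTS : T ⊆ S) (p : Plane × I × I) :
    (Measure.pi fun _ : Fin n => nodeLaw) (Prod.mk p ⁻¹' (allIn n S \ allIn n T)) =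
      nodeLaw (Prod.mk p.1 ⁻¹' S) ^ n - nodeLaw (Prod.mk p.1 ⁻¹' T) ^ n := by
  have hbox : ∀ U, Prod.mk p ⁻¹' (allIn n U) = Set.univ.pi fun _ : Fin n => Prod.mk p.1 ⁻¹' U := by
    intro U; ext y; simp [allIn]
  have hsub : Prod.mk p ⁻¹' (allIn n T) ⊆ Prod.mk p ⁻¹' (allIn n S) := fun q hq j => hTS (hq j)
  rw [Set.preimage_sdiff, measure_sdiff hsub
    (measurable_prodMk_left (measurableSet_allIn n hT)).nullMeasurableSet (measure_ne_top _ _),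
    hbox, hbox, Measure.pi_pi, Measure.pi_pi]
  simp

theorem forall_ne_iff_mem_allIn {n : ℕ} (i : Fin (n + 1)) (U : Set (Plane × Plane × I × I))
    (ω : (ℕ → Plane) × (Sym2 ℕ → I) × (Sym2 ℕ → I)) :
    (∀ j, j ≠ i → (ω.1 i, viewFrom i ω j) ∈ U) ↔
      MeasurableEquiv.piFinSuccAbove (fun _ => Plane × I × I) i (viewFrom i ω) ∈ allIn n U := by
  rw [i.forall_iff_succAbove]
  have h : MeasurableEquiv.piFinSuccAbove (fun _ => Plane × I × I) i (viewFrom i ω) =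
    (viewFrom i ω i, fun j => viewFrom i ω (i.succAbove j)) := rfl
  rw [h]
  simp [allIn, viewFrom]

/-- The probability that all other nodes lie in the section of `S` at the position of node `i`,
but not all of them lie in the section of `T`. -/
theorem configLaw_forall_diff {n : ℕ} (i : Fin (n + 1)) {S T : Set (Plane × Plane × I × I)}
    (hS : MeasurableSet S) (hT : MeasurableSet T) (hTS : T ⊆ S) :
    configLaw {ω | (∀ j, j ≠ i → (ω.1 i, viewFrom i ω j) ∈ S) ∧
        ¬ ∀ j, j ≠ i → (ω.1 i, viewFrom i ω j) ∈ T} =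
      ∫⁻ x in unitSquare, nodeLaw (Prod.mk x ⁻¹' S) ^ n - nodeLaw (Prod.mk x ⁻¹' T) ^ n := by
  have key := (measurePreserving_piFinSuccAbove (fun _ : Fin (n + 1) => nodeLaw) i).comp
    (measurePreserving_viewFrom i)
  have hset : {ω : (ℕ → Plane) × (Sym2 ℕ → I) × (Sym2 ℕ → I) |
      (∀ j, j ≠ i → (ω.1 i, viewFrom i ω j) ∈ S) ∧
        ¬ ∀ j, j ≠ i → (ω.1 i, viewFrom i ω j) ∈ T} =
      (MeasurableEquiv.piFinSuccAbove (fun _ => Plane × I × I) i ∘ viewFrom i) ⁻¹'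
        (allIn n S \ allIn n T) := by
    ext ω
    exact and_congr (forall_ne_iff_mem_allIn i S ω) (not_congr (forall_ne_iff_mem_allIn i T ω))
  have hmeas := (measurableSet_allIn n hS).diff (measurableSet_allIn n hT)
  rw [hset, key.measure_preimage hmeas.nullMeasurableSet, Measure.prod_apply hmeas]
  simp only [measure_allIn_section n hT hTS]
  have hm : ∀ U, MeasurableSet U → Measurable fun x : Plane => nodeLaw (Prod.mk x ⁻¹' U) :=
    fun U hU => measurable_measure_prodMk_left hU
  exact lintegral_nodeLaw_fst (f := fun x =>
    nodeLaw (Prod.mk x ⁻¹' S) ^ n - nodeLaw (Prod.mk x ⁻¹' T) ^ n)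
    (((hm S hS).pow_const n).sub ((hm T hT).pow_const n))

/-! ### Connection functions and the toroidal distance -/

theorem torusDist_nonneg (x y : Plane) : 0 ≤ torusDist x y :=
  Real.iInf_nonneg fun _ => norm_nonneg _

theorem torusDist_le (x y : Plane) (z : Fin 2 → ℤ) :
    torusDist x y ≤ ‖x + WithLp.toLp 2 (fun k => (z k : ℝ)) - y‖ :=
  ciInf_le ⟨0, by rintro _ ⟨z, rfl⟩; exact norm_nonneg _⟩ z

theorem torusDist_le_norm_sub (x y : Plane) : torusDist x y ≤ ‖x - y‖ := by
  refine (torusDist_le x y 0).trans_eq ?_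
  congr 1
  ext k
  simp

theorem measurable_torusDist : Measurable fun p : Plane × Plane => torusDist p.1 p.2 := by
  unfold torusDist
  exact Measurable.iInf fun z => by fun_prop

theorem measurableSet_unitSquare : MeasurableSet unitSquare := by
  have : unitSquare = ⋂ k : Fin 2, (fun x : Plane => x k) ⁻¹' Set.Ico (-1 / 2 : ℝ) (1 / 2) := by
    ext x
    simp [unitSquare]
  rw [this]
  exact MeasurableSet.iInter fun k => (by fun_prop : Measurable _) measurableSet_Ico

namespace IsConnectionFunction

variable {g : ℝ → ℝ}

theorem measurable_comp (hg : IsConnectionFunction g) {α : Type*} [MeasurableSpace α] {f : α → ℝ}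
    (hf : Measurable f) (h0 : ∀ a, 0 ≤ f a) : Measurable fun a => g (f a) := by
  have h : Antitone fun x => g (max x 0) := fun x y hxy =>
    hg.antitoneOn (le_max_right x 0) (le_max_right y 0) (max_le_max hxy le_rfl)
  have := h.measurable.comp hf
  convert this using 2 with a
  simp [h0 a]

theorem le_torus (hg : IsConnectionFunction g) {r : ℝ} (hr : 0 ≤ r) (x y : Plane) :
    g (‖x - y‖ / r) ≤ g (torusDist x y / r) :=
  hg.antitoneOn (div_nonneg (torusDist_nonneg x y) hr) (div_nonneg (norm_nonneg _) hr)
    (div_le_div_of_nonneg_right (torusDist_le_norm_sub x y) hr)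

end IsConnectionFunction

/-! ### Probabilities of not being connected -/

theorem volume_unitInterval_lt {t : ℝ} (h0 : 0 ≤ t) (h1 : t ≤ 1) :
    (volume : Measure I) {m | (m : ℝ) < t} = ENNReal.ofReal t := by
  have := unitInterval.volume_Iio ⟨t, h0, h1⟩
  exact this

theorem volume_unitInterval_ge {t : ℝ} (h0 : 0 ≤ t) (h1 : t ≤ 1) :
    (volume : Measure I) {m | t ≤ (m : ℝ)} = ENNReal.ofReal (1 - t) := by
  have := unitInterval.volume_Ici ⟨t, h0, h1⟩
  exact this

theorem volume_marks_removed {s t : ℝ} (hs : 0 ≤ s) (hst : s ≤ t) (ht : t ≤ 1) :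
    ((volume : Measure I).prod (volume : Measure I))
      {m | ¬ ((m.1 : ℝ) < t ∧ ¬ (m.2 : ℝ) < 1 - s / t)} = ENNReal.ofReal (1 - s) := by
  have ht0 : 0 ≤ t := hs.trans hst
  have hq0 : 0 ≤ s / t := div_nonneg hs ht0
  have hq1 : s / t ≤ 1 := div_le_one_of_le₀ hst ht0
  have h : {m : I × I | ¬ ((m.1 : ℝ) < t ∧ ¬ (m.2 : ℝ) < 1 - s / t)} =
      ({m : I | (m : ℝ) < t} ×ˢ {m : I | 1 - s / t ≤ (m : ℝ)})ᶜ := by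
    ext m
    simp
  rw [h, prob_compl_eq_one_sub, Measure.prod_prod, volume_unitInterval_lt ht0 ht,
    volume_unitInterval_ge (by linarith) (by linarith), ← ENNReal.ofReal_mul ht0,
    ENNReal.ofReal_sub _ hs, ENNReal.ofReal_one]
  · congr 2
    -- If `t = 0` then `s = 0` as well, so the default value of `s / t` does no harm; otherwise `t *
    -- (s / t) = s`.
    rcases ht0.eq_or_lt with h | h
    · rw [← h] at hst ⊢
      linarith
    · field_simp
      ring
  · exact (measurableSet_lt (by fun_prop) (by fun_prop)).prod
      (measurableSet_le (by fun_prop) (by fun_prop))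

theorem volume_marks {t : ℝ} (h0 : 0 ≤ t) (h1 : t ≤ 1) :
    ((volume : Measure I).prod (volume : Measure I)) {m | ¬ (m.1 : ℝ) < t} =
      ENNReal.ofReal (1 - t) := by
  have h : {m : I × I | ¬ (m.1 : ℝ) < t} = {m : I | t ≤ (m : ℝ)} ×ˢ Set.univ := by
    ext m
    simp
  rw [h, Measure.prod_prod, volume_unitInterval_ge h0 h1]
  simp

/-- The quadruples of two positions and two marks for which there is no connection on the torus. -/
def torusApart (g : ℝ → ℝ) (r : ℝ) : Set (Plane × Plane × I × I) :=
  {p | ¬ (p.2.2.1 : ℝ) < g (torusDist p.1 p.2.1 / r)}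

/-- The quadruples of two positions and two marks for which there is no connection on the
square. -/
def squareApart (g : ℝ → ℝ) (r : ℝ) : Set (Plane × Plane × I × I) :=
  {p | ¬ ((p.2.2.1 : ℝ) < g (torusDist p.1 p.2.1 / r) ∧
    ¬ (p.2.2.2 : ℝ) < 1 - g (‖p.1 - p.2.1‖ / r) / g (torusDist p.1 p.2.1 / r))}

theorem torusApart_subset (g : ℝ → ℝ) (r : ℝ) : torusApart g r ⊆ squareApart g r :=
  fun _ hp h => hp h.1

theorem IsConnectionFunction.measurable_torus {g : ℝ → ℝ} (hg : IsConnectionFunction g) {r : ℝ}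
    (hr : 0 ≤ r) {α : Type*} [MeasurableSpace α] {u v : α → Plane} (hu : Measurable u)
    (hv : Measurable v) : Measurable fun a => g (torusDist (u a) (v a) / r) :=
  hg.measurable_comp ((measurable_torusDist.comp (hu.prodMk hv)).div_const r)
    fun _ => div_nonneg (torusDist_nonneg _ _) hr

theorem IsConnectionFunction.measurable_square {g : ℝ → ℝ} (hg : IsConnectionFunction g) {r : ℝ}
    (hr : 0 ≤ r) {α : Type*} [MeasurableSpace α] {u v : α → Plane} (hu : Measurable u)
    (hv : Measurable v) : Measurable fun a => g (‖u a - v a‖ / r) :=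
  hg.measurable_comp (by fun_prop) fun _ => div_nonneg (norm_nonneg _) hr

theorem measurableSet_torusApart {g : ℝ → ℝ} (hg : IsConnectionFunction g) {r : ℝ} (hr : 0 ≤ r) :
    MeasurableSet (torusApart g r) :=
  (measurableSet_lt (by fun_prop)
    (hg.measurable_torus hr measurable_fst (measurable_fst.comp measurable_snd))).compl

theorem measurableSet_squareApart {g : ℝ → ℝ} (hg : IsConnectionFunction g) {r : ℝ} (hr : 0 ≤ r) :
    MeasurableSet (squareApart g r) := by
  have ht := hg.measurable_torus hr (measurable_fst (α := Plane) (β := Plane × I × I))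
    (measurable_fst.comp measurable_snd)
  have hs := hg.measurable_square hr (measurable_fst (α := Plane) (β := Plane × I × I))
    (measurable_fst.comp measurable_snd)
  exact ((measurableSet_lt (by fun_prop) ht).inter
    (measurableSet_lt (by fun_prop) (measurable_const.sub (hs.div ht))).compl).compl

/-- The probability that a node at position `x` is connected, on the square, to a given other
node. -/
def squareProb (g : ℝ → ℝ) (r : ℝ) (x : Plane) : ℝ :=
  ∫ y in unitSquare, g (‖x - y‖ / r)

/-- The probability that a node at position `x` is connected, on the torus, to a given other
node. -/
def torusProb (g : ℝ → ℝ) (r : ℝ) (x : Plane) : ℝ :=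
  ∫ y in unitSquare, g (torusDist x y / r)

theorem IsConnectionFunction.integrable_of_mem {g : ℝ → ℝ} (hg : IsConnectionFunction g)
    {f : Plane → ℝ} (hf : ∀ y, 0 ≤ f y) (hm : Measurable fun y => g (f y)) :
    Integrable (fun y => g (f y)) ((volume : Measure Plane).restrict unitSquare) :=
  (integrable_const (1 : ℝ)).mono' hm.aestronglyMeasurable <| ae_of_all _ fun y => by
    rw [Real.norm_eq_abs, abs_of_nonneg (hg.mem_Icc _ (hf y)).1]
    exact (hg.mem_Icc _ (hf y)).2

theorem IsConnectionFunction.integrable_torus {g : ℝ → ℝ} (hg : IsConnectionFunction g) {r : ℝ}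
    (hr : 0 ≤ r) (x : Plane) : Integrable (fun y => g (torusDist x y / r))
      ((volume : Measure Plane).restrict unitSquare) :=
  hg.integrable_of_mem (fun _ => div_nonneg (torusDist_nonneg _ _) hr)
    (hg.measurable_torus hr measurable_const measurable_id)

theorem IsConnectionFunction.integrable_square {g : ℝ → ℝ} (hg : IsConnectionFunction g) {r : ℝ}
    (hr : 0 ≤ r) (x : Plane) : Integrable (fun y => g (‖x - y‖ / r))
      ((volume : Measure Plane).restrict unitSquare) :=
  hg.integrable_of_mem (fun _ => div_nonneg (norm_nonneg _) hr)
    (hg.measurable_square hr measurable_const measurable_id)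

theorem lintegral_one_sub {f : Plane → ℝ}
    (hf : Integrable f ((volume : Measure Plane).restrict unitSquare)) (h1 : ∀ y, f y ≤ 1) :
    ∫⁻ y in unitSquare, ENNReal.ofReal (1 - f y) =
      ENNReal.ofReal (1 - ∫ y in unitSquare, f y) := by
  have hi : Integrable (fun y => 1 - f y) ((volume : Measure Plane).restrict unitSquare) :=
    (integrable_const _).sub hf
  rw [← ofReal_integral_eq_lintegral_ofReal hi
    (ae_of_all _ fun y => sub_nonneg.2 (h1 y)), integral_sub (integrable_const _) hf]
  simp [Measure.real]

theorem nodeLaw_torusApart {g : ℝ → ℝ} (hg : IsConnectionFunction g) {r : ℝ} (hr : 0 ≤ r)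
    (x : Plane) :
    nodeLaw (Prod.mk x ⁻¹' torusApart g r) = ENNReal.ofReal (1 - torusProb g r x) := by
  have hI : ∀ y, g (torusDist x y / r) ∈ Set.Icc (0 : ℝ) 1 := fun y =>
    hg.mem_Icc _ (div_nonneg (torusDist_nonneg _ _) hr)
  rw [nodeLaw, Measure.prod_apply (measurable_prodMk_left (measurableSet_torusApart hg hr)),
    torusProb, ← lintegral_one_sub (hg.integrable_torus hr x) fun y => (hI y).2]
  exact lintegral_congr fun y => volume_marks (hI y).1 (hI y).2

theorem nodeLaw_squareApart {g : ℝ → ℝ} (hg : IsConnectionFunction g) {r : ℝ} (hr : 0 ≤ r)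
    (x : Plane) :
    nodeLaw (Prod.mk x ⁻¹' squareApart g r) = ENNReal.ofReal (1 - squareProb g r x) := by
  have hI : ∀ y, g (torusDist x y / r) ∈ Set.Icc (0 : ℝ) 1 := fun y =>
    hg.mem_Icc _ (div_nonneg (torusDist_nonneg _ _) hr)
  have hJ : ∀ y, g (‖x - y‖ / r) ∈ Set.Icc (0 : ℝ) 1 := fun y =>
    hg.mem_Icc _ (div_nonneg (norm_nonneg _) hr)
  rw [nodeLaw, Measure.prod_apply (measurable_prodMk_left (measurableSet_squareApart hg hr)),
    squareProb, ← lintegral_one_sub (hg.integrable_square hr x) fun y => (hJ y).2]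
  exact lintegral_congr fun y => volume_marks_removed (hJ y).1 (hg.le_torus hr x y) (hI y).2

theorem IsConnectionFunction.squareProb_le_torusProb {g : ℝ → ℝ} (hg : IsConnectionFunction g)
    {r : ℝ} (hr : 0 ≤ r) (x : Plane) : squareProb g r x ≤ torusProb g r x :=
  integral_mono (hg.integrable_square hr x) (hg.integrable_torus hr x) fun y =>
    hg.le_torus hr x y

theorem IsConnectionFunction.torusProb_le_one {g : ℝ → ℝ} (hg : IsConnectionFunction g)
    {r : ℝ} (hr : 0 ≤ r) (x : Plane) : torusProb g r x ≤ 1 := by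
  refine (integral_mono (hg.integrable_torus hr x) (integrable_const (1 : ℝ)) fun y =>
    (hg.mem_Icc _ (div_nonneg (torusDist_nonneg _ _) hr)).2).trans ?_
  simp

/-! ### The first moment bound -/

/-- The configurations in which node `i` of the nodes `0, …, n` is isolated on the square but not on
the torus. -/
def boundaryIsolated (g : ℝ → ℝ) (r : ℝ) {n : ℕ} (i : Fin (n + 1)) :
    Set ((ℕ → Plane) × (Sym2 ℕ → I) × (Sym2 ℕ → I)) :=
  {ω | (∀ j, j ≠ i → (ω.1 i, viewFrom i ω j) ∈ squareApart g r) ∧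
        ¬ ∀ j, j ≠ i → (ω.1 i, viewFrom i ω j) ∈ torusApart g r}

theorem configLaw_boundaryIsolated {g : ℝ → ℝ} (hg : IsConnectionFunction g) {r : ℝ} (hr : 0 ≤ r)
    {n : ℕ} (i : Fin (n + 1)) :
    configLaw (boundaryIsolated g r i) = ∫⁻ x in unitSquare,
      ENNReal.ofReal ((1 - squareProb g r x) ^ n - (1 - torusProb g r x) ^ n) := by
  rw [boundaryIsolated, configLaw_forall_diff i (measurableSet_squareApart hg hr)
    (measurableSet_torusApart hg hr) (torusApart_subset g r)]
  refine lintegral_congr fun x => ?_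
  have h1 := hg.torusProb_le_one hr x
  have h2 := hg.squareProb_le_torusProb hr x
  rw [nodeLaw_squareApart hg hr, nodeLaw_torusApart hg hr, ← ENNReal.ofReal_pow (by linarith),
    ← ENNReal.ofReal_pow (by linarith), ENNReal.ofReal_sub _ (by
      exact pow_nonneg (by linarith) _)]

theorem exists_boundaryIsolated {g : ℝ → ℝ} {r : ℝ} {ω : Sample}
    (hω : boundaryIsolatedCount g r ω ≠ 0) :
    ∃ m : ℕ, ω.1 = m + 1 ∧ ∃ i : Fin (m + 1), ω.2 ∈ boundaryIsolated g r i := by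
  obtain ⟨n, ω⟩ := ω
  obtain ⟨i, hi⟩ := Set.nonempty_of_ncard_ne_zero hω
  obtain ⟨m, rfl⟩ : ∃ m, n = m + 1 := Nat.exists_eq_succ_of_ne_zero (Fin.pos i).ne'
  refine ⟨m, rfl, i, ?_, ?_⟩
  · intro j hj h
    exact hi.1 j ⟨⟨hj.symm, h.1⟩, h.2⟩
  · intro h
    exact hi.2 fun j hj => h j hj.1.symm hj.2

/-- Size-biasing: summed over the choice of a node, the number of other nodes is again Poisson, with
total weight `ρ`. -/
theorem poisson_mul_succ (ρ : ℝ) (n : ℕ) :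
    Real.exp (-ρ) * ρ ^ (n + 1) / (n + 1).factorial * (n + 1) =
      ρ * (Real.exp (-ρ) * (ρ ^ n / n.factorial)) := by
  rw [Nat.factorial_succ]
  have : ((n.factorial : ℕ) : ℝ) ≠ 0 := by positivity
  push_cast
  field_simp
  ring

/-- The Poisson generating function, evaluated at `1 - p` and at `1 - q`. -/
theorem hasSum_poisson_pow_sub (ρ p q : ℝ) :
    HasSum (fun n : ℕ => ρ * (Real.exp (-ρ) * (ρ ^ n / n.factorial)) * ((1 - p) ^ n - (1 - q) ^ n))
      (ρ * (Real.exp (-(ρ * p)) - Real.exp (-(ρ * q)))) := by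
  have h : ∀ s : ℝ, HasSum (fun n : ℕ => Real.exp (-ρ) * (ρ ^ n / n.factorial) * (1 - s) ^ n)
      (Real.exp (-(ρ * s))) := by
    intro s
    have := (NormedSpace.expSeries_div_hasSum_exp (ρ * (1 - s))).mul_left (Real.exp (-ρ))
    rw [← Real.exp_eq_exp_ℝ, ← Real.exp_add] at this
    have h2 : -ρ + ρ * (1 - s) = -(ρ * s) := by ring
    rw [h2] at this
    refine this.congr_fun fun n => ?_
    rw [mul_pow]
    ring
  refine (((h p).sub (h q)).mul_left ρ).congr_fun fun n => ?_
  ring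

/-- A union bound over the number of nodes and the choice of the affected node. Only subadditivity
is used, so the event need not be shown measurable. -/
theorem sampleLaw_boundaryIsolatedCount_ne_zero_le {g : ℝ → ℝ} (hg : IsConnectionFunction g)
    {r : ℝ} (hr : 0 ≤ r) (ρ : ℝ≥0) :
    sampleLaw ρ {ω | boundaryIsolatedCount g r ω ≠ 0} ≤ ∫⁻ x in unitSquare,
      ENNReal.ofReal (ρ * (Real.exp (-(ρ * squareProb g r x)) -
        Real.exp (-(ρ * torusProb g r x)))) := by
  have hsub : {ω | boundaryIsolatedCount g r ω ≠ 0} ⊆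
      ⋃ m : ℕ, {m + 1} ×ˢ ⋃ i : Fin (m + 1), boundaryIsolated g r i := by
    intro ω hω
    obtain ⟨m, hm, i, hi⟩ := exists_boundaryIsolated hω
    exact Set.mem_iUnion.2 ⟨m, hm, Set.mem_iUnion.2 ⟨i, hi⟩⟩
  have hpow : ∀ (n : ℕ) (x : Plane),
      0 ≤ (1 - squareProb g r x) ^ n - (1 - torusProb g r x) ^ n := by
    intro n x
    have h1 := hg.torusProb_le_one hr x
    have h2 := hg.squareProb_le_torusProb hr x
    exact sub_nonneg.2 (pow_le_pow_left₀ (by linarith) (by linarith) n)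
  have hmS : Measurable (squareProb g r) :=
    (StronglyMeasurable.integral_prod_right'
      (hg.measurable_square hr measurable_fst measurable_snd).stronglyMeasurable).measurable
  have hmT : Measurable (torusProb g r) :=
    (StronglyMeasurable.integral_prod_right'
      (hg.measurable_torus hr measurable_fst measurable_snd).stronglyMeasurable).measurable
  calc sampleLaw ρ {ω | boundaryIsolatedCount g r ω ≠ 0}
      ≤ ∑' m : ℕ, sampleLaw ρ ({m + 1} ×ˢ ⋃ i : Fin (m + 1), boundaryIsolated g r i) :=
        (measure_mono hsub).trans (measure_iUnion_le _)
    _ ≤ ∑' m : ℕ, ∫⁻ x in unitSquare,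
          ENNReal.ofReal (ρ * (Real.exp (-ρ) * (ρ ^ m / m.factorial)) *
            ((1 - squareProb g r x) ^ m - (1 - torusProb g r x) ^ m)) := by
        refine ENNReal.tsum_le_tsum fun m => ?_
        have h1 : sampleLaw ρ ({m + 1} ×ˢ ⋃ i : Fin (m + 1), boundaryIsolated g r i) =
            poissonMeasure ρ {m + 1} * configLaw (⋃ i : Fin (m + 1), boundaryIsolated g r i) :=
          Measure.prod_prod _ _
        have h2 : configLaw (⋃ i : Fin (m + 1), boundaryIsolated g r i) ≤
            (m + 1 : ℕ) * ∫⁻ x in unitSquare, ENNReal.ofReal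
              ((1 - squareProb g r x) ^ m - (1 - torusProb g r x) ^ m) := by
          refine (measure_iUnion_le _).trans ?_
          simp only [configLaw_boundaryIsolated hg hr]
          simp
        rw [h1, poissonMeasure_singleton]
        refine (mul_le_mul_right h2 _).trans ?_
        rw [← mul_assoc, ← ENNReal.ofReal_natCast, ← ENNReal.ofReal_mul (by positivity),
          Nat.cast_succ, poisson_mul_succ, ← lintegral_const_mul' _ _ ENNReal.ofReal_ne_top]
        refine lintegral_mono fun x => ?_
        rw [← ENNReal.ofReal_mul (by positivity)]
    _ = ∫⁻ x in unitSquare, ∑' m : ℕ,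
          ENNReal.ofReal (ρ * (Real.exp (-ρ) * (ρ ^ m / m.factorial)) *
            ((1 - squareProb g r x) ^ m - (1 - torusProb g r x) ^ m)) :=
        (lintegral_tsum fun m => by fun_prop).symm
    _ = _ := by
        refine lintegral_congr fun x => ?_
        have hs := hasSum_poisson_pow_sub ρ (squareProb g r x) (torusProb g r x)
        rw [← ENNReal.ofReal_tsum_of_nonneg (fun m => mul_nonneg (by positivity) (hpow m x))
          hs.summable, hs.tsum_eq]

/-! ### The mass of a half-plane -/

/-- The mass of a half-plane at distance `t` from the origin and orthogonal to the `k`-th axis. -/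
def halfPlaneMass (g : ℝ → ℝ) (k : Fin 2) (t : ℝ) : ℝ :=
  ∫ u in {u : Plane | t ≤ u k}, g ‖u‖

theorem measurableSet_halfPlane (k : Fin 2) (t : ℝ) : MeasurableSet {u : Plane | t ≤ u k} :=
  measurableSet_le (by fun_prop) (by fun_prop)

theorem integral_neg_halfPlane (g : ℝ → ℝ) (k : Fin 2) (t : ℝ) :
    ∫ u in {u : Plane | t ≤ -u k}, g ‖u‖ = halfPlaneMass g k t := by
  have hs : MeasurableSet {u : Plane | t ≤ -u k} :=
    measurableSet_le (by fun_prop) (by fun_prop)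
  rw [halfPlaneMass, ← integral_indicator hs, ← integral_indicator (measurableSet_halfPlane k t),
    ← integral_neg_eq_self]
  congr 1 with u
  simp [Set.indicator]

/-- The open box with sides `t` and `s` in the positive quadrant. -/
theorem volume_box (k : Fin 2) {s t : ℝ} (hs : 0 ≤ s) (ht : 0 ≤ t) :
    (volume : Measure Plane).real {u | ∀ j, u j ∈ Set.Ioo 0 (if j = k then t else s)} = t * s := by
  have h : {u : Plane | ∀ j, u j ∈ Set.Ioo 0 (if j = k then t else s)} =
      (WithLp.ofLp : Plane → Fin 2 → ℝ) ⁻¹'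
        (Set.pi Set.univ fun j => Set.Ioo 0 (if j = k then t else s)) := by
    ext x
    simp
  rw [Measure.real, h, (PiLp.volume_preserving_ofLp (Fin 2)).measure_preimage
    (MeasurableSet.univ_pi fun _ => measurableSet_Ioo).nullMeasurableSet, Real.volume_pi_Ioo]
  fin_cases k <;> simp [hs, ht, mul_comm]

/-- In polar coordinates the decay hypothesis compares `y * g y` with this derivative, whose tail
integral is exactly `1 / log t`. -/
theorem hasDerivAt_neg_inv_log {x : ℝ} (hx : 1 < x) :
    HasDerivAt (fun x => -(Real.log x)⁻¹) (1 / (x * Real.log x ^ 2)) x := by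
  have hl := Real.log_pos hx
  have := ((Real.hasDerivAt_log (by linarith : x ≠ 0)).inv hl.ne').neg
  refine this.congr_deriv ?_
  rw [neg_div, neg_neg, inv_eq_one_div, div_div]

theorem tendsto_neg_inv_log : Tendsto (fun x => -(Real.log x)⁻¹) atTop (𝓝 0) := by
  simpa using (Real.tendsto_log_atTop.inv_tendsto_atTop).neg

theorem integral_Ioi_inv_mul_log_sq {t : ℝ} (ht : 1 < t) :
    ∫ x in Set.Ioi t, 1 / (x * Real.log x ^ 2) = (Real.log t)⁻¹ := by
  rw [integral_Ioi_of_hasDerivAt_of_nonneg'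
    (fun x hx => hasDerivAt_neg_inv_log (ht.trans_le hx)) (fun x hx => ?_) tendsto_neg_inv_log]
  · ring
  · have : 0 < x := by linarith [Set.mem_Ioi.1 hx]
    positivity

theorem integrableOn_Ioi_inv_mul_log_sq {t : ℝ} (ht : 1 < t) :
    IntegrableOn (fun x => 1 / (x * Real.log x ^ 2)) (Set.Ioi t) := by
  refine integrableOn_Ioi_deriv_of_nonneg'
    (fun x hx => hasDerivAt_neg_inv_log (ht.trans_le hx)) (fun x hx => ?_) tendsto_neg_inv_log
  have : 0 < x := by linarith [Set.mem_Ioi.1 hx]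
  positivity

namespace IsConnectionFunction

variable {g : ℝ → ℝ}

theorem nonneg_norm (hg : IsConnectionFunction g) (u : Plane) : 0 ≤ g ‖u‖ :=
  (hg.mem_Icc _ (norm_nonneg _)).1

theorem halfPlaneMass_nonneg (hg : IsConnectionFunction g) (k : Fin 2) (t : ℝ) :
    0 ≤ halfPlaneMass g k t :=
  integral_nonneg fun u => hg.nonneg_norm u

theorem antitone_halfPlaneMass (hg : IsConnectionFunction g) (k : Fin 2) :
    Antitone (halfPlaneMass g k) := fun _ _ hst =>
  setIntegral_mono_set hg.integrable.integrableOn (ae_of_all _ hg.nonneg_norm)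
    (ae_of_all _ fun _ hu => hst.trans hu)

/-- The two opposite half-planes and a box between them are disjoint. -/
theorem two_mul_halfPlaneMass_add_le (hg : IsConnectionFunction g) (k : Fin 2) {t : ℝ} (ht : 0 < t)
    {s : Set Plane} (hs : MeasurableSet s) (hst : ∀ u ∈ s, |u k| < t) :
    2 * halfPlaneMass g k t + ∫ u in s, g ‖u‖ ≤ ∫ u : Plane, g ‖u‖ := by
  have h2 : MeasurableSet {u : Plane | t ≤ -u k} :=
    measurableSet_le (by fun_prop) (by fun_prop)
  have hd1 : Disjoint {u : Plane | t ≤ u k} {u : Plane | t ≤ -u k} := by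
    refine Set.disjoint_left.2 fun u h1 h2 => ?_
    simp only [Set.mem_ofPred_eq] at h1 h2
    linarith
  have hd2 : Disjoint ({u : Plane | t ≤ u k} ∪ {u : Plane | t ≤ -u k}) s := by
    refine Set.disjoint_left.2 fun u h1 h2 => ?_
    have := abs_lt.1 (hst u h2)
    rcases h1 with h1 | h1 <;> simp only [Set.mem_ofPred_eq] at h1 <;> linarith
  have hI := hg.integrable
  calc 2 * halfPlaneMass g k t + ∫ u in s, g ‖u‖
      = ∫ u in ({u : Plane | t ≤ u k} ∪ {u : Plane | t ≤ -u k}) ∪ s, g ‖u‖ := by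
        rw [setIntegral_union hd2 hs hI.integrableOn hI.integrableOn,
          setIntegral_union hd1 h2 hI.integrableOn hI.integrableOn, integral_neg_halfPlane,
          halfPlaneMass]
        ring
    _ ≤ _ := setIntegral_le_integral hI (ae_of_all _ hg.nonneg_norm)

theorem exists_pos_value (hg : IsConnectionFunction g) : ∃ s, 0 < s ∧ 0 < g s := by
  by_contra! h
  have h0 : ∀ᵐ u : Plane, g ‖u‖ = 0 := by
    filter_upwards [compl_mem_ae_iff.2 (measure_singleton (0 : Plane))] with u hu
    exact le_antisymm (h _ (norm_pos_iff.2 hu)) (hg.nonneg_norm u)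
  have := hg.integral_pos
  rw [integral_congr_ae h0] at this
  simp at this

/-- Two opposite half-planes at distance `t` miss a box between them on which `g` is bounded below.
-/
theorem exists_halfPlaneMass_le (hg : IsConnectionFunction g) (k : Fin 2) :
    ∃ c s, 0 < c ∧ 0 < s ∧ ∀ t, 0 < t →
      halfPlaneMass g k t ≤ (∫ u : Plane, g ‖u‖) / 2 - c * min t s := by
  obtain ⟨a, ha, hga⟩ := hg.exists_pos_value
  -- The box has sides `min t (a / 2)` and `a / 2`, so it lies in the disc of radius `a`, where `g ≥
  -- g a`. The last division by 2 shares the loss between the two half-planes.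
  refine ⟨g a * (a / 2) / 2, a / 2, by positivity, by positivity, fun t ht => ?_⟩
  set m := min t (a / 2) with hm
  have hm0 : 0 < m := lt_min ht (by positivity)
  set B : Set Plane := {u | ∀ j, u j ∈ Set.Ioo 0 (if j = k then m else a / 2)} with hB
  have hBm : MeasurableSet B := by
    have : B = ⋂ j : Fin 2, (fun x : Plane => x j) ⁻¹'
        Set.Ioo 0 (if j = k then m else a / 2) := by
      ext x
      simp [hB]
    rw [this]
    exact MeasurableSet.iInter fun k => (by fun_prop : Measurable _) measurableSet_Ioo
  have hBv : (volume : Measure Plane).real B = m * (a / 2) :=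
    volume_box k (by positivity) hm0.le
  have hlow : ∀ u ∈ B, g a ≤ g ‖u‖ := by
    intro u hu
    refine hg.antitoneOn (norm_nonneg u) ha.le ?_
    have hj : ∀ j, u j ^ 2 ≤ (a / 2) ^ 2 := by
      intro j
      have h1 := hu j
      have h2 : u j ≤ a / 2 := by
        split_ifs at h1
        · exact h1.2.le.trans (min_le_right _ _)
        · exact h1.2.le
      exact pow_le_pow_left₀ h1.1.le h2 2
    refine le_of_sq_le_sq ?_ ha.le
    rw [EuclideanSpace.real_norm_sq_eq, Fin.sum_univ_two]
    nlinarith [hj 0, hj 1]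
  have hint : g a * (m * (a / 2)) ≤ ∫ u in B, g ‖u‖ := by
    have hfin : volume B ≠ ⊤ := by
      intro h
      rw [Measure.real, h] at hBv
      have : 0 < m * (a / 2) := by positivity
      simp at hBv
      rcases hBv with h | h <;> linarith
    have := setIntegral_ge_of_const_le_real hBm hfin hlow hg.integrable.integrableOn
    rwa [hBv] at this
  have := hg.two_mul_halfPlaneMass_add_le k ht hBm fun u hu => by
    have := hu k
    rw [if_pos rfl] at this
    rw [abs_of_pos this.1]
    exact this.2.trans_le (min_le_left _ _)
  linarith

/-- The half-plane lies outside the open disc of radius `t`; the rest is polar coordinates. -/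
theorem halfPlaneMass_le_radial (hg : IsConnectionFunction g) (k : Fin 2) {t : ℝ} (ht : 0 < t) :
    halfPlaneMass g k t ≤
      2 * (volume : Measure Plane).real (Metric.ball 0 1) * ∫ y in Set.Ioi t, y * g y := by
  have hrad := integral_fun_norm_addHaar (volume : Measure Plane) ((Set.Ici t).indicator g)
  have h1 : halfPlaneMass g k t ≤ ∫ u : Plane, (Set.Ici t).indicator g ‖u‖ := by
    have hset : MeasurableSet {u : Plane | t ≤ ‖u‖} :=
      measurableSet_le (by fun_prop) (by fun_prop)
    have : ∫ u : Plane, (Set.Ici t).indicator g ‖u‖ = ∫ u in {u : Plane | t ≤ ‖u‖}, g ‖u‖ := by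
      rw [← integral_indicator hset]
      congr 1
    rw [this]
    refine setIntegral_mono_set hg.integrable.integrableOn (ae_of_all _ hg.nonneg_norm)
      (ae_of_all _ fun u hu => ?_)
    exact le_trans (le_trans hu (le_abs_self _)) (PiLp.norm_apply_le u k)
  have h2 : ∫ y in Set.Ioi (0 : ℝ), y * (Set.Ici t).indicator g y = ∫ y in Set.Ioi t, y * g y := by
    have : (fun y => y * (Set.Ici t).indicator g y) = (Set.Ici t).indicator fun y => y * g y := by
      ext y
      simp only [Set.indicator]
      split_ifs <;> simp
    rw [this, setIntegral_indicator measurableSet_Ici,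
      Set.inter_eq_right.2 (Set.Ici_subset_Ioi.2 ht), integral_Ici_eq_integral_Ioi]
  refine h1.trans_eq ?_
  rw [hrad]
  simp only [finrank_euclideanSpace_fin, pow_one, smul_eq_mul, nsmul_eq_mul, Nat.cast_ofNat,
    Nat.add_one_sub_one, h2]
  ring

theorem eventually_halfPlaneMass_mul_log_le (hg : IsConnectionFunction g) (k : Fin 2) {ε : ℝ}
    (hε : 0 < ε) : ∀ᶠ t in atTop, halfPlaneMass g k t * Real.log t ≤ ε := by
  set v := (volume : Measure Plane).real (Metric.ball 0 1)
  have hv : 0 ≤ v := measureReal_nonneg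
  -- This makes `2 * v * δ ≤ ε`; the `+ 1` makes the denominator visibly positive.
  set δ := ε / (2 * v + 1) with hδ
  have hδ0 : 0 < δ := by positivity
  obtain ⟨t₀, ht₀⟩ := eventually_atTop.1 (hg.isLittleO.bound hδ0)
  filter_upwards [eventually_ge_atTop t₀, eventually_gt_atTop 1] with t ht h1
  have hl := Real.log_pos h1
  have hbound : ∀ y ∈ Set.Ioi t, y * g y ≤ δ * (1 / (y * Real.log y ^ 2)) := by
    intro y hy
    have hy1 : 1 < y := h1.trans hy
    have hly := Real.log_pos hy1
    have := ht₀ y (ht.trans (le_of_lt hy))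
    rw [Real.norm_eq_abs, Real.norm_eq_abs, abs_of_nonneg (hg.mem_Icc y (by linarith)).1,
      abs_of_nonneg (by positivity)] at this
    calc y * g y ≤ y * (δ * (1 / (y ^ 2 * Real.log y ^ 2))) :=
          mul_le_mul_of_nonneg_left this (by linarith)
      _ = _ := by
        have : y ≠ 0 := by linarith
        field_simp
  have hint : ∫ y in Set.Ioi t, y * g y ≤ δ * (Real.log t)⁻¹ := by
    rw [← integral_Ioi_inv_mul_log_sq h1, ← integral_const_mul]
    refine integral_mono_of_nonneg ?_ ((integrableOn_Ioi_inv_mul_log_sq h1).const_mul δ) ?_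
    · refine (ae_restrict_iff' measurableSet_Ioi).2 (ae_of_all _ fun y hy => ?_)
      have hy0 : 0 ≤ y := by linarith [Set.mem_Ioi.1 hy]
      exact mul_nonneg hy0 (hg.mem_Icc y hy0).1
    · exact (ae_restrict_iff' measurableSet_Ioi).2 (ae_of_all _ hbound)
  calc halfPlaneMass g k t * Real.log t
      ≤ (2 * v * (δ * (Real.log t)⁻¹)) * Real.log t := by
        refine mul_le_mul_of_nonneg_right ?_ hl.le
        exact (hg.halfPlaneMass_le_radial k (by linarith)).trans
          (mul_le_mul_of_nonneg_left hint (by positivity))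
    _ = 2 * v * δ := by field_simp
    _ ≤ (2 * v + 1) * δ := by nlinarith
    _ = ε := by rw [hδ]; field_simp

theorem tendsto_halfPlaneMass_mul_log (hg : IsConnectionFunction g) (k : Fin 2) :
    Tendsto (fun t => halfPlaneMass g k t * Real.log t) atTop (𝓝 0) := by
  refine tendsto_order.2 ⟨fun a ha => ?_, fun a ha => ?_⟩
  · filter_upwards [eventually_gt_atTop 1] with t ht
    exact ha.trans_le (mul_nonneg (hg.halfPlaneMass_nonneg k t) (Real.log_pos ht).le)
  · filter_upwards [hg.eventually_halfPlaneMass_mul_log_le k (half_pos ha)] with t ht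
    linarith

/-- The fraction `1 / 10` only has to be below `1 / 4`, the exponent of the strip width `δ =
ρ^{-1/4}` used later. -/
theorem exists_halfPlaneMass_le_max (hg : IsConnectionFunction g) (k : Fin 2) :
    ∃ c, 0 < c ∧ ∀ t, 0 < t → halfPlaneMass g k t ≤
      max ((∫ u : Plane, g ‖u‖) / 10) ((∫ u : Plane, g ‖u‖) / 2 - c * t) := by
  obtain ⟨c, s, hc, hs, h⟩ := hg.exists_halfPlaneMass_le k
  have hC := hg.integral_pos
  obtain ⟨T, h1, hT, hlog⟩ := ((eventually_gt_atTop 0).and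
    ((hg.eventually_halfPlaneMass_mul_log_le k (ε := (∫ u : Plane, g ‖u‖) / 10)
      (by positivity)).and (Real.tendsto_log_atTop.eventually_ge_atTop 1))).exists
  have hFT : halfPlaneMass g k T ≤ (∫ u : Plane, g ‖u‖) / 10 := by
    nlinarith [hg.halfPlaneMass_nonneg k T]
  -- For `t ≤ T` the factor makes the slope small enough that `min 1 (s / T) * t ≤ min t s`.
  refine ⟨c * min 1 (s / T), by positivity, fun t ht => ?_⟩
  rcases le_total T t with htT | htT
  · exact le_max_of_le_left ((hg.antitone_halfPlaneMass k htT).trans hFT)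
  · refine le_max_of_le_right ((h t ht).trans ?_)
    rw [mul_assoc]
    refine sub_le_sub_left (mul_le_mul_of_nonneg_left (le_min ?_ ?_) hc.le) _
    · exact mul_le_of_le_one_left ht.le (min_le_left _ _)
    · calc min 1 (s / T) * t ≤ s / T * T :=
          mul_le_mul (min_le_right _ _) htT ht.le (by positivity)
        _ = s := by field_simp

end IsConnectionFunction

/-! ### Bounds on the connection probabilities -/

theorem integral_comp_sub_div (φ : Plane → ℝ) (x : Plane) (r : ℝ) :
    ∫ y, φ (r⁻¹ • (y - x)) = r ^ 2 * ∫ u, φ u := by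
  rw [integral_sub_right_eq_self (fun y => φ (r⁻¹ • y)) x, Measure.integral_comp_inv_smul,
    finrank_euclideanSpace_fin, abs_of_nonneg (sq_nonneg r), smul_eq_mul]

theorem norm_inv_smul_sub {r : ℝ} (hr : 0 ≤ r) (x y : Plane) :
    ‖r⁻¹ • (y - x)‖ = ‖x - y‖ / r := by
  rw [norm_smul, Real.norm_eq_abs, abs_of_nonneg (inv_nonneg.2 hr), norm_sub_rev]
  ring

theorem integral_comp_norm_sub_div (g : ℝ → ℝ) {r : ℝ} (hr : 0 ≤ r) (x : Plane) :
    ∫ y : Plane, g (‖x - y‖ / r) = r ^ 2 * ∫ u : Plane, g ‖u‖ := by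
  rw [← integral_comp_sub_div _ x]
  simp only [norm_inv_smul_sub hr]

theorem setIntegral_halfPlane (g : ℝ → ℝ) {r : ℝ} (hr : 0 < r) (x : Plane) (k : Fin 2) (a : ℝ) :
    ∫ y in {y : Plane | a ≤ y k}, g (‖x - y‖ / r) =
      r ^ 2 * halfPlaneMass g k ((a - x k) / r) := by
  rw [halfPlaneMass, ← integral_indicator (measurableSet_halfPlane _ _),
    ← integral_indicator (measurableSet_halfPlane _ _), ← integral_comp_sub_div _ x]
  congr 1 with y
  have h : (a - x k) / r ≤ (r⁻¹ • (y - x)) k ↔ a ≤ y k := by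
    simp only [PiLp.smul_apply, PiLp.sub_apply, smul_eq_mul]
    rw [inv_mul_eq_div, div_le_div_iff_of_pos_right hr]
    constructor <;> intro h <;> linarith
  simp only [Set.indicator, Set.mem_ofPred_eq, h, norm_inv_smul_sub hr.le]

theorem setIntegral_neg_halfPlane (g : ℝ → ℝ) {r : ℝ} (hr : 0 < r) (x : Plane) (k : Fin 2)
    (a : ℝ) : ∫ y in {y : Plane | a ≤ -y k}, g (‖x - y‖ / r) =
      r ^ 2 * halfPlaneMass g k ((a + x k) / r) := by
  have h := setIntegral_halfPlane g hr (-x) k a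
  rw [PiLp.neg_apply, sub_neg_eq_add] at h
  rw [← h, ← integral_indicator (measurableSet_halfPlane _ _),
    ← integral_indicator (measurableSet_le (by fun_prop) (by fun_prop)), ← integral_neg_eq_self]
  congr 1 with y
  have : ‖-x - y‖ = ‖x - -y‖ := by rw [← norm_neg]; congr 1; abel
  simp [Set.indicator, this]

theorem setIntegral_union_le {α : Type*} [MeasurableSpace α] {μ : Measure α} {f : α → ℝ}
    (hf : Integrable f μ) (h0 : ∀ a, 0 ≤ f a) (s : Set α) {t : Set α} (ht : MeasurableSet t) :
    ∫ a in s ∪ t, f a ∂μ ≤ ∫ a in s, f a ∂μ + ∫ a in t, f a ∂μ := by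
  rw [Set.union_comm, ← integral_inter_add_sdiff ht hf.integrableOn]
  have h1 := setIntegral_mono_set (s := (t ∪ s) ∩ t) (t := t) hf.integrableOn (ae_of_all _ h0)
    (ae_of_all _ fun _ h => h.2)
  have h2 := setIntegral_mono_set (s := (t ∪ s) \ t) (t := s) hf.integrableOn (ae_of_all _ h0)
    (ae_of_all _ fun _ h => h.1.resolve_left h.2)
  linarith

theorem compl_unitSquare_subset : unitSquareᶜ ⊆
    ({y : Plane | 1 / 2 ≤ y 0} ∪ {y : Plane | 1 / 2 ≤ -y 0}) ∪
      ({y : Plane | 1 / 2 ≤ y 1} ∪ {y : Plane | 1 / 2 ≤ -y 1}) := by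
  intro y hy
  by_contra h
  simp only [Set.mem_union, Set.mem_ofPred_eq, not_or, not_le] at h
  refine hy fun k => ?_
  fin_cases k
  · exact ⟨by simp; linarith [h.1.2], h.1.1⟩
  · exact ⟨by simp; linarith [h.2.2], h.2.1⟩

/-- The missing mass, in units of `r²`, on the two sides of a point of the unit interval. -/
def sideMass (g : ℝ → ℝ) (r : ℝ) (k : Fin 2) (x : ℝ) : ℝ :=
  halfPlaneMass g k ((1 / 2 - x) / r) + halfPlaneMass g k ((1 / 2 + x) / r)

namespace IsConnectionFunction

variable {g : ℝ → ℝ}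

theorem integrable_comp_norm_sub_div (hg : IsConnectionFunction g) {r : ℝ} (hr : 0 < r)
    (x : Plane) : Integrable fun y : Plane => g (‖x - y‖ / r) := by
  have h := (hg.integrable.comp_smul (inv_ne_zero hr.ne')).comp_sub_right x
  simpa only [norm_inv_smul_sub hr.le] using h

/-- The complement of the square is covered by four half-planes, whose overlaps at the corners are
counted twice. -/
theorem le_squareProb (hg : IsConnectionFunction g) {r : ℝ} (hr : 0 < r) (x : Plane) :
    r ^ 2 * ((∫ u : Plane, g ‖u‖) - (sideMass g r 0 (x 0) + sideMass g r 1 (x 1))) ≤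
      squareProb g r x := by
  have hI := hg.integrable_comp_norm_sub_div hr x
  have h0 : ∀ y : Plane, 0 ≤ g (‖x - y‖ / r) := fun y =>
    (hg.mem_Icc _ (div_nonneg (norm_nonneg _) hr.le)).1
  have hN : ∀ k : Fin 2, MeasurableSet {y : Plane | 1 / 2 ≤ -y k} := fun k =>
    measurableSet_le (by fun_prop) (by fun_prop)
  have hP : ∀ k : Fin 2, MeasurableSet {y : Plane | 1 / 2 ≤ y k} := fun k =>
    measurableSet_halfPlane _ _
  have htot := integral_add_compl measurableSet_unitSquare hI
  rw [integral_comp_norm_sub_div g hr.le] at htot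
  have h1 := setIntegral_mono_set hI.integrableOn (ae_of_all _ h0)
    compl_unitSquare_subset.eventuallyLE
  have h2 := setIntegral_union_le hI h0
    ({y : Plane | 1 / 2 ≤ y 0} ∪ {y : Plane | 1 / 2 ≤ -y 0}) ((hP 1).union (hN 1))
  have h3 := setIntegral_union_le hI h0 {y : Plane | 1 / 2 ≤ y 0} (hN 0)
  have h4 := setIntegral_union_le hI h0 {y : Plane | 1 / 2 ≤ y 1} (hN 1)
  simp only [setIntegral_halfPlane g hr, setIntegral_neg_halfPlane g hr] at h3 h4
  rw [squareProb]
  unfold sideMass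
  linarith

end IsConnectionFunction

theorem exists_norm_le_torusDist (x y : Plane) :
    ∃ z : Fin 2 → ℤ, ‖x + WithLp.toLp 2 (fun k => (z k : ℝ)) - y‖ ≤ torusDist x y := by
  -- Rounding minimizes each coordinate separately, hence the norm.
  refine ⟨fun k => round (y k - x k), le_ciInf fun w => ?_⟩
  rw [EuclideanSpace.norm_eq, EuclideanSpace.norm_eq]
  refine Real.sqrt_le_sqrt (Finset.sum_le_sum fun k _ => pow_le_pow_left₀ (norm_nonneg _) ?_ 2)
  have h : ∀ a : ℝ, |x k + a - y k| = |y k - x k - a| := fun a => by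
    rw [abs_sub_comm, sub_add_eq_sub_sub]
  simp only [PiLp.sub_apply, PiLp.add_apply, Real.norm_eq_abs, h]
  exact round_le (y k - x k) (w k)

theorem eq_of_add_mem_unitSquare {y : Plane} {z w : Fin 2 → ℤ}
    (hz : y + WithLp.toLp 2 (fun k => (z k : ℝ)) ∈ unitSquare)
    (hw : y + WithLp.toLp 2 (fun k => (w k : ℝ)) ∈ unitSquare) : z = w := by
  ext k
  have h1 := hz k
  have h2 := hw k
  simp only [PiLp.add_apply, Set.mem_Ico] at h1 h2
  have h3 : ((z k : ℤ) : ℝ) < w k + 1 := by linarith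
  have h4 : ((w k : ℤ) : ℝ) < z k + 1 := by linarith
  norm_cast at h3 h4
  omega

/-- The translates of the unit square are disjoint, so that wrapping does not increase an
integral. -/
theorem lintegral_tsum_translate_le {h : Plane → ENNReal} (hh : Measurable h) :
    ∫⁻ y in unitSquare, ∑' z : Fin 2 → ℤ, h (y - WithLp.toLp 2 (fun k => (z k : ℝ))) ≤
      ∫⁻ y, h y := by
  have hm : ∀ z : Fin 2 → ℤ, Measurable fun y : Plane =>
      unitSquare.indicator (1 : Plane → ENNReal) (y + WithLp.toLp 2 (fun k => (z k : ℝ))) * h y :=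
    fun z => ((measurable_one.indicator measurableSet_unitSquare).comp (by fun_prop)).mul hh
  calc ∫⁻ y in unitSquare, ∑' z : Fin 2 → ℤ, h (y - WithLp.toLp 2 (fun k => (z k : ℝ)))
      = ∑' z : Fin 2 → ℤ, ∫⁻ y in unitSquare, h (y - WithLp.toLp 2 (fun k => (z k : ℝ))) :=
        lintegral_tsum fun z => by fun_prop
    _ = ∑' z : Fin 2 → ℤ, ∫⁻ y, unitSquare.indicator (1 : Plane → ENNReal)
          (y + WithLp.toLp 2 (fun k => (z k : ℝ))) * h y := by
        refine tsum_congr fun z => ?_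
        rw [← lintegral_indicator measurableSet_unitSquare,
          ← lintegral_add_right_eq_self _ (WithLp.toLp 2 (fun k => (z k : ℝ)) : Plane)]
        refine lintegral_congr fun y => ?_
        simp only [Set.indicator, add_sub_cancel_right]
        split_ifs <;> simp
    _ = ∫⁻ y, ∑' z : Fin 2 → ℤ, unitSquare.indicator (1 : Plane → ENNReal)
          (y + WithLp.toLp 2 (fun k => (z k : ℝ))) * h y :=
        (lintegral_tsum fun z => (hm z).aemeasurable).symm
    _ ≤ ∫⁻ y, h y := by
        refine lintegral_mono fun y => ?_
        by_cases hex : ∃ z : Fin 2 → ℤ, y + WithLp.toLp 2 (fun k => (z k : ℝ)) ∈ unitSquare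
        · obtain ⟨z, hz⟩ := hex
          rw [tsum_eq_single z fun w hw => ?_]
          · simp [hz]
          · rw [Set.indicator_of_notMem fun hw' => hw (eq_of_add_mem_unitSquare hw' hz), zero_mul]
        · push Not at hex
          simp [hex]

/-- The nearest translate is one term of the sum over all translates, and that sum integrates to at
most the mass of the plane. -/
theorem IsConnectionFunction.torusProb_le {g : ℝ → ℝ} (hg : IsConnectionFunction g) {r : ℝ}
    (hr : 0 < r) (x : Plane) : torusProb g r x ≤ r ^ 2 * ∫ u : Plane, g ‖u‖ := by
  have hC := hg.integral_pos
  have h0 : ∀ y : Plane, 0 ≤ g (‖x - y‖ / r) := fun y =>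
    (hg.mem_Icc _ (div_nonneg (norm_nonneg _) hr.le)).1
  have hm : Measurable fun y => ENNReal.ofReal (g (‖x - y‖ / r)) :=
    (hg.measurable_square hr.le measurable_const measurable_id).ennreal_ofReal
  rw [← ENNReal.ofReal_le_ofReal_iff (by positivity), ← integral_comp_norm_sub_div g hr.le x,
    ofReal_integral_eq_lintegral_ofReal (hg.integrable_comp_norm_sub_div hr x) (ae_of_all _ h0),
    torusProb, ofReal_integral_eq_lintegral_ofReal (hg.integrable_torus hr.le x)
      (ae_of_all _ fun y => (hg.mem_Icc _ (div_nonneg (torusDist_nonneg _ _) hr.le)).1)]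
  refine le_trans (lintegral_mono fun y => ?_) (lintegral_tsum_translate_le hm)
  obtain ⟨z, hz⟩ := exists_norm_le_torusDist x y
  refine le_trans (ENNReal.ofReal_le_ofReal ?_) (ENNReal.le_tsum z)
  have h : x - (y - WithLp.toLp 2 (fun k => (z k : ℝ))) =
      x + WithLp.toLp 2 (fun k => (z k : ℝ)) - y := by abel
  rw [h]
  exact hg.antitoneOn (div_nonneg (norm_nonneg _) hr.le)
    (div_nonneg (torusDist_nonneg x y) hr.le) (div_le_div_of_nonneg_right hz hr.le)

/-! ### The contribution of one coordinate -/

theorem integral_exp_neg_mul_half_sub_le {a : ℝ} (ha : 0 < a) :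
    ∫ x in (-1 / 2 : ℝ)..(1 / 2), Real.exp (-a * (1 / 2 - x)) ≤ a⁻¹ := by
  rw [intervalIntegral.integral_comp_sub_left (fun y => Real.exp (-a * y)),
    intervalIntegral.integral_comp_mul_left (fun y => Real.exp y) (by linarith : -a ≠ 0),
    integral_exp, smul_eq_mul, inv_neg]
  have : Real.exp (-a * (1 / 2 - 1 / 2)) = 1 := by simp
  rw [this]
  have h1 := (Real.exp_pos (-a * (1 / 2 - -1 / 2))).le
  have h2 := inv_pos.2 ha
  nlinarith

theorem integral_exp_neg_mul_half_add_le {a : ℝ} (ha : 0 < a) :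
    ∫ x in (-1 / 2 : ℝ)..(1 / 2), Real.exp (-a * (1 / 2 + x)) ≤ a⁻¹ := by
  have h := intervalIntegral.integral_comp_neg (a := -1 / 2) (b := 1 / 2)
    fun x => Real.exp (-a * (1 / 2 - x))
  simp only [sub_neg_eq_add] at h
  rw [h, show -(1 / 2 : ℝ) = -1 / 2 by norm_num, show -(-1 / 2 : ℝ) = 1 / 2 by norm_num]
  exact integral_exp_neg_mul_half_sub_le ha

namespace IsConnectionFunction

variable {g : ℝ → ℝ}

theorem sideMass_nonneg (hg : IsConnectionFunction g) (r : ℝ) (k : Fin 2) (x : ℝ) :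
    0 ≤ sideMass g r k x :=
  add_nonneg (hg.halfPlaneMass_nonneg _ _) (hg.halfPlaneMass_nonneg _ _)

theorem measurable_sideMass (hg : IsConnectionFunction g) (r : ℝ) (k : Fin 2) :
    Measurable (sideMass g r k) :=
  ((hg.antitone_halfPlaneMass k).measurable.comp (by fun_prop)).add
    ((hg.antitone_halfPlaneMass k).measurable.comp (by fun_prop))

theorem halfPlaneMass_le_integral (hg : IsConnectionFunction g) (k : Fin 2) (t : ℝ) :
    halfPlaneMass g k t ≤ ∫ u : Plane, g ‖u‖ :=
  setIntegral_le_integral hg.integrable (ae_of_all _ hg.nonneg_norm)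

theorem exp_sideMass_le (hg : IsConnectionFunction g) {μ : ℝ} (hμ : 0 ≤ μ) (r : ℝ) (k : Fin 2)
    (x : ℝ) : Real.exp (μ * sideMass g r k x) ≤ Real.exp (μ * (2 * ∫ u : Plane, g ‖u‖)) := by
  refine Real.exp_le_exp.2 (mul_le_mul_of_nonneg_left ?_ hμ)
  have h1 := hg.halfPlaneMass_le_integral k ((1 / 2 - x) / r)
  have h2 := hg.halfPlaneMass_le_integral k ((1 / 2 + x) / r)
  unfold sideMass
  linarith

theorem integrable_exp_sideMass (hg : IsConnectionFunction g) {μ : ℝ} (hμ : 0 ≤ μ) (r : ℝ)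
    (k : Fin 2) (ν : Measure ℝ) [IsFiniteMeasure ν] :
    Integrable (fun x => Real.exp (μ * sideMass g r k x)) ν := by
  refine (integrable_const (Real.exp (μ * (2 * ∫ u : Plane, g ‖u‖)))).mono'
    ((hg.measurable_sideMass r k).const_mul μ).exp.aestronglyMeasurable (ae_of_all _ fun x => ?_)
  rw [Real.norm_eq_abs, abs_of_nonneg (Real.exp_pos _).le]
  exact hg.exp_sideMass_le hμ r k x

/-- One summand for each regime: `u ≥ δ`, and for `u ≤ δ` the two alternatives of the maximum. The
factor `exp (1 - u / δ)`, at least 1 for `u ≤ δ`, is a smooth substitute for the indicator of the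
strip. -/
theorem exp_halfPlaneMass_le (hg : IsConnectionFunction g) {k : Fin 2} {c : ℝ}
    (hc : ∀ t, 0 < t → halfPlaneMass g k t ≤
      max ((∫ u : Plane, g ‖u‖) / 10) ((∫ u : Plane, g ‖u‖) / 2 - c * t))
    {μ r δ u : ℝ} (hμ : 0 ≤ μ) (hr : 0 < r) (hδ : 0 < δ) (hu : 0 < u) :
    Real.exp (μ * halfPlaneMass g k (u / r)) ≤ Real.exp (μ * halfPlaneMass g k (δ / r)) +
      (Real.exp (1 + μ * (∫ u : Plane, g ‖u‖) / 10) * Real.exp (-δ⁻¹ * u) +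
      Real.exp (μ * (∫ u : Plane, g ‖u‖) / 2) * Real.exp (-(c * μ / r) * u)) := by
  have p1 := Real.exp_pos (μ * halfPlaneMass g k (δ / r))
  rw [← Real.exp_add, ← Real.exp_add]
  have p2 := Real.exp_pos (1 + μ * (∫ u : Plane, g ‖u‖) / 10 + -δ⁻¹ * u)
  have p3 := Real.exp_pos (μ * (∫ u : Plane, g ‖u‖) / 2 + -(c * μ / r) * u)
  rcases le_total δ u with h | h
  · have : Real.exp (μ * halfPlaneMass g k (u / r)) ≤ Real.exp (μ * halfPlaneMass g k (δ / r)) :=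
      Real.exp_le_exp.2 (mul_le_mul_of_nonneg_left (hg.antitone_halfPlaneMass k
        (div_le_div_of_nonneg_right h hr.le)) hμ)
    linarith
  · rcases le_max_iff.1 (hc (u / r) (by positivity)) with h1 | h1
    · have h2 : δ⁻¹ * u ≤ 1 := by
        rw [inv_mul_eq_div]
        exact div_le_one_of_le₀ h hδ.le
      have h3 := mul_le_mul_of_nonneg_left h1 hμ
      have : Real.exp (μ * halfPlaneMass g k (u / r)) ≤
          Real.exp (1 + μ * (∫ u : Plane, g ‖u‖) / 10 + -δ⁻¹ * u) :=
        Real.exp_le_exp.2 (by rw [neg_mul, mul_div_assoc]; linarith)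
      linarith
    · have h3 := mul_le_mul_of_nonneg_left h1 hμ
      have : Real.exp (μ * halfPlaneMass g k (u / r)) ≤
          Real.exp (μ * (∫ u : Plane, g ‖u‖) / 2 + -(c * μ / r) * u) :=
        Real.exp_le_exp.2 (h3.trans_eq (by ring))
      linarith

theorem integral_exp_sideMass_le (hg : IsConnectionFunction g) {k : Fin 2} {c : ℝ} (hc0 : 0 < c)
    (hc : ∀ t, 0 < t → halfPlaneMass g k t ≤
      max ((∫ u : Plane, g ‖u‖) / 10) ((∫ u : Plane, g ‖u‖) / 2 - c * t))
    {μ r δ q : ℝ} (hμ : 0 < μ) (hr : 0 < r) (hδ : 0 < δ) (hδ2 : δ ≤ 1 / 2)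
    (hq : μ * halfPlaneMass g k (δ / r) ≤ q) :
    ∫ x in (-1 / 2 : ℝ)..(1 / 2), Real.exp (μ * sideMass g r k x) ≤
      Real.exp q * (Real.exp q + 2 * (Real.exp (1 + μ * (∫ u : Plane, g ‖u‖) / 10) * δ +
        Real.exp (μ * (∫ u : Plane, g ‖u‖) / 2) * (r / (c * μ)))) := by
  set M := Real.exp (1 + μ * (∫ u : Plane, g ‖u‖) / 10) with hM
  set N := Real.exp (μ * (∫ u : Plane, g ‖u‖) / 2) with hN
  set a := c * μ / r with ha
  have ha0 : 0 < a := by positivity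
  have hM0 : 0 < M := Real.exp_pos _
  have hN0 : 0 < N := Real.exp_pos _
  have hone : ∀ u, 0 < u → Real.exp (μ * halfPlaneMass g k (u / r)) ≤ Real.exp q +
      (M * Real.exp (-δ⁻¹ * u) + N * Real.exp (-a * u)) := fun u hu =>
    (hg.exp_halfPlaneMass_le hc hμ.le hr hδ hu).trans
      (by have := Real.exp_le_exp.2 hq; linarith)
  have hfar : ∀ u, 1 / 2 ≤ u → Real.exp (μ * halfPlaneMass g k (u / r)) ≤ Real.exp q := fun u hu =>
    Real.exp_le_exp.2 ((mul_le_mul_of_nonneg_left (hg.antitone_halfPlaneMass k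
      (div_le_div_of_nonneg_right (hδ2.trans hu) hr.le)) hμ.le).trans hq)
  have hpt : ∀ x ∈ Set.Ioo (-1 / 2 : ℝ) (1 / 2), Real.exp (μ * sideMass g r k x) ≤
      Real.exp q * (Real.exp q + ((M * Real.exp (-δ⁻¹ * (1 / 2 - x)) +
        N * Real.exp (-a * (1 / 2 - x))) + (M * Real.exp (-δ⁻¹ * (1 / 2 + x)) +
        N * Real.exp (-a * (1 / 2 + x))))) := by
    intro x hx
    have p1 : 0 < M * Real.exp (-δ⁻¹ * (1 / 2 - x)) + N * Real.exp (-a * (1 / 2 - x)) := by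
      positivity
    have p2 : 0 < M * Real.exp (-δ⁻¹ * (1 / 2 + x)) + N * Real.exp (-a * (1 / 2 + x)) := by
      positivity
    rw [sideMass, mul_add, Real.exp_add]
    -- The side across the centre is at distance at least `1 / 2 ≥ δ` and costs only `exp q`.
    -- Including the terms of both sides gives a single bound for both halves.
    rcases le_total 0 x with h | h
    · rw [mul_comm]
      refine mul_le_mul (hfar _ (by linarith)) ((hone _ (by linarith [hx.2])).trans ?_)
        (Real.exp_pos _).le (Real.exp_pos _).le
      linarith
    · refine mul_le_mul (hfar _ (by linarith)) ((hone _ (by linarith [hx.1])).trans ?_)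
        (Real.exp_pos _).le (Real.exp_pos _).le
      linarith
  have hint : ∀ f : ℝ → ℝ, Continuous f → IntervalIntegrable f volume (-1 / 2) (1 / 2) :=
    fun f hf => hf.intervalIntegrable _ _
  refine (intervalIntegral.integral_mono_on_of_le_Ioo (by norm_num) ?_
    (hint _ (by fun_prop)) hpt).trans ?_
  · rw [intervalIntegrable_iff_integrableOn_Ioc_of_le (by norm_num)]
    exact hg.integrable_exp_sideMass hμ.le r k _
  · rw [intervalIntegral.integral_const_mul, intervalIntegral.integral_add (hint _ (by fun_prop))
      (hint _ (by fun_prop)), intervalIntegral.integral_add (hint _ (by fun_prop))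
      (hint _ (by fun_prop)), intervalIntegral.integral_add (hint _ (by fun_prop))
      (hint _ (by fun_prop)), intervalIntegral.integral_add (hint _ (by fun_prop))
      (hint _ (by fun_prop)), intervalIntegral.integral_const_mul,
      intervalIntegral.integral_const_mul, intervalIntegral.integral_const_mul,
      intervalIntegral.integral_const_mul, intervalIntegral.integral_const]
    refine mul_le_mul_of_nonneg_left ?_ (Real.exp_pos _).le
    have hd : 0 < δ⁻¹ := inv_pos.2 hδ
    have i1 := mul_le_mul_of_nonneg_left (integral_exp_neg_mul_half_sub_le hd) hM0.le
    have i2 := mul_le_mul_of_nonneg_left (integral_exp_neg_mul_half_add_le hd) hM0.le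
    have i3 := mul_le_mul_of_nonneg_left (integral_exp_neg_mul_half_sub_le ha0) hN0.le
    have i4 := mul_le_mul_of_nonneg_left (integral_exp_neg_mul_half_add_le ha0) hN0.le
    rw [inv_inv] at i1 i2
    have h5 : a⁻¹ = r / (c * μ) := by rw [ha, inv_div]
    rw [h5] at i3 i4
    have h6 : ((1 / 2 : ℝ) - -1 / 2) • Real.exp q = Real.exp q := by
      rw [smul_eq_mul]; ring
    rw [h6]
    linarith

/-! ### Asymptotics -/

theorem scale_exp_sq (hg : IsConnectionFunction g) {b l : ℝ} (hl : 0 ≤ l + b) :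
    scale g b (Real.exp l) ^ 2 = (l + b) / ((∫ u : Plane, g ‖u‖) * Real.exp l) := by
  have := hg.integral_pos
  rw [scale, Real.log_exp, Real.sq_sqrt (by positivity)]

theorem exp_mul_scale_sq (hg : IsConnectionFunction g) {b l : ℝ} (hl : 0 ≤ l + b) :
    Real.exp l * scale g b (Real.exp l) ^ 2 = (l + b) / ∫ u : Plane, g ‖u‖ := by
  have := hg.integral_pos
  rw [hg.scale_exp_sq hl]
  field_simp

theorem scale_pos (hg : IsConnectionFunction g) {b l : ℝ} (hl : 0 < l + b) :
    0 < scale g b (Real.exp l) := by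
  have := hg.integral_pos
  rw [scale, Real.log_exp]
  positivity

/-- The exponent `3 / 8` is below `1 / 2`, which absorbs the logarithm, and above `1 / 4`, so that
`δ / r ≥ e^{l / 8}` for `δ = e^{-l / 4}`. -/
theorem eventually_scale_le (hg : IsConnectionFunction g) (b : ℝ) :
    ∀ᶠ l in atTop, scale g b (Real.exp l) ≤ Real.exp (-(3 / 8 * l)) := by
  have hC := hg.integral_pos
  -- Here `l + b ≤ 2 l`, while `C e^{l / 4} ≥ C l² / 32`; the latter dominates once `l ≥ 64 / C`.
  filter_upwards [eventually_ge_atTop b, eventually_ge_atTop (64 / ∫ u : Plane, g ‖u‖),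
    eventually_gt_atTop 0] with l h1 h2 h3
  rw [scale, Real.log_exp]
  refine Real.sqrt_le_iff.2 ⟨(Real.exp_pos _).le, ?_⟩
  rw [div_le_iff₀ (by positivity)]
  have h4 : Real.exp (-(3 / 8 * l)) ^ 2 * ((∫ u : Plane, g ‖u‖) * Real.exp l) =
      (∫ u : Plane, g ‖u‖) * Real.exp (l / 4) := by
    rw [← Real.exp_nat_mul, mul_left_comm, ← Real.exp_add]
    congr 2
    push_cast
    ring
  rw [h4]
  have h5 := Real.quadratic_le_exp_of_nonneg (x := l / 4) (by positivity)
  have h6 := mul_le_mul_of_nonneg_left h5 hC.le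
  rw [div_le_iff₀ hC] at h2
  nlinarith

theorem tendsto_add_div_self (b : ℝ) : Tendsto (fun l : ℝ => (l + b) / l) atTop (𝓝 1) := by
  have h : Tendsto (fun l : ℝ => 1 + b / l) atTop (𝓝 (1 + 0)) :=
    tendsto_const_nhds.add (tendsto_const_nhds.div_atTop tendsto_id)
  rw [add_zero] at h
  refine h.congr' ?_
  filter_upwards [eventually_ne_atTop 0] with l hl
  rw [add_div, div_self hl]

theorem tendsto_mul_halfPlaneMass_exp (hg : IsConnectionFunction g) (b : ℝ) (k : Fin 2) :
    Tendsto (fun l => (l + b) / (∫ u : Plane, g ‖u‖) * halfPlaneMass g k (Real.exp (l / 8))) atTop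
      (𝓝 0) := by
  have hC := hg.integral_pos
  have h1 : Tendsto (fun l : ℝ => Real.exp (l / 8)) atTop atTop :=
    Real.tendsto_exp_atTop.comp (tendsto_id.atTop_div_const (by norm_num))
  have h2 := ((tendsto_add_div_self b).const_mul (8 / ∫ u : Plane, g ‖u‖)).mul
    ((hg.tendsto_halfPlaneMass_mul_log k).comp h1)
  rw [mul_zero] at h2
  refine h2.congr' ?_
  filter_upwards [eventually_ne_atTop 0] with l hl
  simp only [Function.comp_apply, Real.log_exp]
  field_simp

/-- The growth `e^{l / 2}`, from losing half the mass at a side, cancels the `e^{-l / 2}` in the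
scale exactly; a multiple of `(l + b)^{-1/2}` remains. -/
theorem tendsto_exp_mul_scale (hg : IsConnectionFunction g) (b : ℝ) {c : ℝ} (hc : 0 < c) :
    Tendsto (fun l => Real.exp ((l + b) / 2) *
      (scale g b (Real.exp l) / (c * ((l + b) / ∫ u : Plane, g ‖u‖)))) atTop (𝓝 0) := by
  have hC := hg.integral_pos
  have hdiv : Tendsto (fun l => Real.exp b * (∫ u : Plane, g ‖u‖) / c ^ 2 / (l + b)) atTop (𝓝 0) :=
    tendsto_const_nhds.div_atTop (tendsto_atTop_add_const_right _ _ tendsto_id)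
  have h := hdiv.sqrt
  rw [Real.sqrt_zero] at h
  refine h.congr' ?_
  filter_upwards [eventually_gt_atTop (-b)] with l hl
  have hl' : 0 < l + b := by linarith
  have hs := hg.scale_pos hl'
  rw [Real.sqrt_eq_iff_mul_self_eq (by positivity) (by positivity)]
  have h1 : Real.exp ((l + b) / 2) * Real.exp ((l + b) / 2) = Real.exp l * Real.exp b := by
    rw [← Real.exp_add, ← Real.exp_add]
    congr 1
    ring
  have h2 := hg.exp_mul_scale_sq hl'.le
  symm
  calc _ = (Real.exp ((l + b) / 2) * Real.exp ((l + b) / 2)) * scale g b (Real.exp l) ^ 2 /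
        (c * ((l + b) / ∫ u : Plane, g ‖u‖)) ^ 2 := by
        rw [← mul_div_assoc, div_mul_div_comm, mul_mul_mul_comm, ← sq, ← sq, ← sq]
    _ = Real.exp b * (Real.exp l * scale g b (Real.exp l) ^ 2) /
        (c * ((l + b) / ∫ u : Plane, g ‖u‖)) ^ 2 := by rw [h1]; ring
    _ = _ := by
        rw [h2]
        field_simp

theorem tendsto_exp_mul_exp_neg (b : ℝ) :
    Tendsto (fun l => Real.exp (1 + (l + b) / 10) * Real.exp (-(l / 4))) atTop (𝓝 0) := by
  have h : Tendsto (fun l : ℝ => Real.exp (-(3 / 20 * l)) * Real.exp (1 + b / 10)) atTop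
      (𝓝 (0 * Real.exp (1 + b / 10))) :=
    (Real.tendsto_exp_neg_atTop_nhds_zero.comp
      (tendsto_id.const_mul_atTop (by norm_num : (0 : ℝ) < 3 / 20))).mul_const _
  rw [zero_mul] at h
  refine h.congr fun l => ?_
  rw [← Real.exp_add, ← Real.exp_add]
  congr 1
  ring

theorem tendsto_integral_exp_sideMass (hg : IsConnectionFunction g) (b : ℝ) (k : Fin 2) :
    Tendsto (fun l => ∫ x in (-1 / 2 : ℝ)..(1 / 2), Real.exp ((l + b) / (∫ u : Plane, g ‖u‖) *
      sideMass g (scale g b (Real.exp l)) k x)) atTop (𝓝 1) := by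
  have hC := hg.integral_pos
  obtain ⟨c, hc0, hc⟩ := hg.exists_halfPlaneMass_le_max k
  have hQ : Tendsto (fun l => Real.exp ((l + b) / (∫ u : Plane, g ‖u‖) *
      halfPlaneMass g k (Real.exp (l / 8)))) atTop (𝓝 1) := by
    have := (Real.continuous_exp.tendsto 0).comp (hg.tendsto_mul_halfPlaneMass_exp b k)
    rwa [Real.exp_zero] at this
  have hU := hQ.mul (hQ.add (((tendsto_exp_mul_exp_neg b).add
    (hg.tendsto_exp_mul_scale b hc0)).const_mul 2))
  rw [add_zero, mul_zero, add_zero, mul_one] at hU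
  refine tendsto_of_tendsto_of_tendsto_of_le_of_le' tendsto_const_nhds hU ?_ ?_
  · filter_upwards [eventually_gt_atTop (-b)] with l hl
    have hμ : 0 ≤ (l + b) / ∫ u : Plane, g ‖u‖ := div_nonneg (by linarith) hC.le
    have h := intervalIntegral.integral_mono_on (a := -1 / 2) (b := 1 / 2) (by norm_num)
      (intervalIntegrable_const (μ := volume) (c := (1 : ℝ)))
      ((intervalIntegrable_iff_integrableOn_Ioc_of_le (by norm_num)).2
        (hg.integrable_exp_sideMass hμ (scale g b (Real.exp l)) k _))
      fun x _ => Real.one_le_exp (mul_nonneg hμ (hg.sideMass_nonneg _ k x))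
    refine le_trans (le_of_eq ?_) h
    rw [intervalIntegral.integral_const]
    norm_num
  · have hexp : ∀ᶠ l : ℝ in atTop, Real.exp (-(l / 4)) ≤ 1 / 2 := by
      have : Tendsto (fun l : ℝ => Real.exp (-(l / 4))) atTop (𝓝 0) :=
        Real.tendsto_exp_neg_atTop_nhds_zero.comp (tendsto_id.atTop_div_const (by norm_num))
      exact this.eventually_le_const (by norm_num)
    filter_upwards [eventually_gt_atTop (-b), hexp, hg.eventually_scale_le b] with l hl h2 h3
    have hl' : 0 < l + b := by linarith
    have hr := hg.scale_pos hl'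
    have hμ : 0 < (l + b) / ∫ u : Plane, g ‖u‖ := by positivity
    -- With `δ = e^{-l / 4}`, this lets `q` be the exponent in `hQ`, which tends to 0.
    have hle : Real.exp (l / 8) ≤ Real.exp (-(l / 4)) / scale g b (Real.exp l) := by
      rw [le_div_iff₀ hr]
      refine (mul_le_mul_of_nonneg_left h3 (Real.exp_pos _).le).trans_eq ?_
      rw [← Real.exp_add]
      congr 1
      ring
    have := hg.integral_exp_sideMass_le hc0 hc hμ hr (Real.exp_pos (-(l / 4))) h2
      (mul_le_mul_of_nonneg_left (hg.antitone_halfPlaneMass k hle) hμ.le)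
    rwa [div_mul_cancel₀ _ hC.ne'] at this

end IsConnectionFunction

/-! ### Conclusion -/

theorem integral_unitSquare_mul {f₀ f₁ : ℝ → ℝ} :
    ∫ x in unitSquare, f₀ (x 0) * f₁ (x 1) =
      (∫ x in (-1 / 2 : ℝ)..(1 / 2), f₀ x) * ∫ x in (-1 / 2 : ℝ)..(1 / 2), f₁ x := by
  have hset : unitSquare = (WithLp.ofLp : Plane → Fin 2 → ℝ) ⁻¹'
      (Set.pi Set.univ fun _ => Set.Ico (-1 / 2 : ℝ) (1 / 2)) := by
    ext x
    simp [unitSquare]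
  have hmp := (PiLp.volume_preserving_ofLp (Fin 2)).restrict_preimage
    (MeasurableSet.univ_pi fun _ : Fin 2 => measurableSet_Ico (a := (-1 / 2 : ℝ)) (b := 1 / 2))
  rw [← hset, volume_pi, Measure.restrict_pi_pi] at hmp
  have h1 := hmp.integral_comp (MeasurableEquiv.toLp 2 (Fin 2 → ℝ)).symm.measurableEmbedding
    fun y : Fin 2 → ℝ => ∏ i, (![f₀, f₁] i) (y i)
  rw [integral_fintype_prod_eq_prod] at h1
  simp only [Fin.prod_univ_two, Matrix.cons_val_zero, Matrix.cons_val_one] at h1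
  rw [h1, intervalIntegral.integral_of_le (by norm_num), intervalIntegral.integral_of_le
    (by norm_num), integral_Ico_eq_integral_Ioc, integral_Ico_eq_integral_Ioc]

theorem integrable_unitSquare_mul {f₀ f₁ : ℝ → ℝ}
    (h₀ : Measurable f₀) (h₁ : Measurable f₁) {B : ℝ} (hb₀ : ∀ x, |f₀ x| ≤ B)
    (hb₁ : ∀ x, |f₁ x| ≤ B) : Integrable (fun x : Plane => f₀ (x 0) * f₁ (x 1))
      ((volume : Measure Plane).restrict unitSquare) := by
  refine (integrable_const (B * B)).mono' (Measurable.aestronglyMeasurable (by fun_prop))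
    (ae_of_all _ fun x => ?_)
  rw [Real.norm_eq_abs, abs_mul]
  exact mul_le_mul (hb₀ _) (hb₁ _) (abs_nonneg _) ((abs_nonneg _).trans (hb₀ 0))

/-- Both exponents are compared with `l + b`: the torus term is bounded below by `e^{-b}`, which is
the `- 1`, and the square term above by the product. -/
theorem IsConnectionFunction.exp_sub_exp_le {g : ℝ → ℝ} (hg : IsConnectionFunction g) {b l : ℝ}
    (hl : 0 < l + b) (x : Plane) :
    Real.exp l * (Real.exp (-(Real.exp l * squareProb g (scale g b (Real.exp l)) x)) -
        Real.exp (-(Real.exp l * torusProb g (scale g b (Real.exp l)) x))) ≤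
      Real.exp (-b) * (Real.exp ((l + b) / (∫ u : Plane, g ‖u‖) *
        sideMass g (scale g b (Real.exp l)) 0 (x 0)) *
      Real.exp ((l + b) / (∫ u : Plane, g ‖u‖) *
        sideMass g (scale g b (Real.exp l)) 1 (x 1)) - 1) := by
  have hC := hg.integral_pos
  have hr := hg.scale_pos hl
  have hsq := hg.exp_mul_scale_sq hl.le
  set r := scale g b (Real.exp l)
  set C := ∫ u : Plane, g ‖u‖
  have hS := mul_le_mul_of_nonneg_left (hg.le_squareProb hr x) (Real.exp_pos l).le
  have hT := mul_le_mul_of_nonneg_left (hg.torusProb_le hr x) (Real.exp_pos l).le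
  rw [← mul_assoc, hsq] at hS hT
  have hCC : (l + b) / C * C = l + b := div_mul_cancel₀ _ hC.ne'
  change (l + b) / C * (C - _) ≤ _ at hS
  change _ ≤ (l + b) / C * C at hT
  rw [mul_sub, hCC] at hS
  rw [hCC] at hT
  rw [mul_sub, mul_sub, mul_one, ← Real.exp_add, ← Real.exp_add, ← Real.exp_add, ← Real.exp_add]
  refine sub_le_sub (Real.exp_le_exp.2 ?_) (Real.exp_le_exp.2 ?_) <;> linarith

theorem IsConnectionFunction.sampleLaw_exp_le {g : ℝ → ℝ} (hg : IsConnectionFunction g) {b l : ℝ}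
    (hl : 0 < l + b) {ρ : ℝ≥0} (hρ : (ρ : ℝ) = Real.exp l) :
    sampleLaw ρ {ω | boundaryIsolatedCount g (scale g b ρ) ω ≠ 0} ≤
      ENNReal.ofReal (Real.exp (-b) * ((∫ x in (-1 / 2 : ℝ)..(1 / 2),
        Real.exp ((l + b) / (∫ u : Plane, g ‖u‖) * sideMass g (scale g b (Real.exp l)) 0 x)) *
        (∫ x in (-1 / 2 : ℝ)..(1 / 2), Real.exp ((l + b) / (∫ u : Plane, g ‖u‖) *
          sideMass g (scale g b (Real.exp l)) 1 x)) - 1)) := by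
  have hC := hg.integral_pos
  have hμ : 0 ≤ (l + b) / ∫ u : Plane, g ‖u‖ := div_nonneg hl.le hC.le
  refine (sampleLaw_boundaryIsolatedCount_ne_zero_le hg (Real.sqrt_nonneg _) ρ).trans ?_
  rw [hρ]
  set r := scale g b (Real.exp l) with hr
  set μ := (l + b) / ∫ u : Plane, g ‖u‖
  have hone : ∀ k x, 1 ≤ Real.exp (μ * sideMass g r k x) := fun k x =>
    Real.one_le_exp (mul_nonneg hμ (hg.sideMass_nonneg _ k x))
  have hbd : ∀ k x, |Real.exp (μ * sideMass g r k x)| ≤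
      Real.exp (μ * (2 * ∫ u : Plane, g ‖u‖)) := by
    intro k x
    rw [abs_of_pos (Real.exp_pos _)]
    exact hg.exp_sideMass_le hμ r k x
  have hint := integrable_unitSquare_mul ((hg.measurable_sideMass r 0).const_mul μ).exp
    ((hg.measurable_sideMass r 1).const_mul μ).exp (hbd 0) (hbd 1)
  have hprod : ∀ x : Plane, 0 ≤ Real.exp (μ * sideMass g r 0 (x 0)) *
      Real.exp (μ * sideMass g r 1 (x 1)) - 1 := fun x =>
    sub_nonneg.2 (one_le_mul_of_one_le_of_one_le (hone 0 _) (hone 1 _))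
  refine (lintegral_mono fun x => ENNReal.ofReal_le_ofReal (hg.exp_sub_exp_le hl x)).trans
    (le_of_eq ?_)
  have hint' : Integrable (fun x : Plane => Real.exp (-b) *
      (Real.exp (μ * sideMass g r 0 (x 0)) * Real.exp (μ * sideMass g r 1 (x 1)) - 1))
      ((volume : Measure Plane).restrict unitSquare) :=
    (hint.sub (integrable_const (1 : ℝ))).const_mul _
  rw [← integral_unitSquare_mul, ← ofReal_integral_eq_lintegral_ofReal hint'
    (ae_of_all _ fun x => mul_nonneg (Real.exp_pos _).le (hprod x)), integral_const_mul]
  congr 2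
  exact (integral_sub hint (integrable_const 1)).trans (by simp)

theorem IsConnectionFunction.tendsto_sampleLaw_ne_zero {g : ℝ → ℝ} (hg : IsConnectionFunction g)
    (b : ℝ) : Tendsto (fun ρ : ℝ≥0 => sampleLaw ρ
      {ω | boundaryIsolatedCount g (scale g b ρ) ω ≠ 0}) atTop (𝓝 0) := by
  have hlog : Tendsto (fun ρ : ℝ≥0 => Real.log ρ) atTop atTop :=
    Real.tendsto_log_atTop.comp (NNReal.tendsto_coe_atTop.2 tendsto_id)
  have h := (((hg.tendsto_integral_exp_sideMass b 0).mul
    (hg.tendsto_integral_exp_sideMass b 1)).sub_const 1).const_mul (Real.exp (-b))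
  rw [mul_one, sub_self, mul_zero] at h
  have h' := (ENNReal.tendsto_ofReal h).comp hlog
  rw [ENNReal.ofReal_zero] at h'
  refine tendsto_of_tendsto_of_tendsto_of_le_of_le' tendsto_const_nhds h'
    (Eventually.of_forall fun _ => zero_le) ?_
  filter_upwards [hlog.eventually_gt_atTop (-b), eventually_gt_atTop 0] with ρ hρ h0
  exact hg.sampleLaw_exp_le (by linarith) (Real.exp_log (NNReal.coe_pos.2 h0)).symm

end RandomConnection

end

theorem mainTheorem6 (g : ℝ → ℝ) (hg : RandomConnection.IsConnectionFunction g) (b : ℝ) :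
    Tendsto
      (fun ρ : ℝ≥0 => RandomConnection.sampleLaw ρ
        {ω | RandomConnection.boundaryIsolatedCount g (RandomConnection.scale g b ρ) ω = 0})
      atTop (𝓝 1) := by
  have h := ENNReal.Tendsto.sub (tendsto_const_nhds (x := (1 : ENNReal)))
    (hg.tendsto_sampleLaw_ne_zero b) (Or.inl ENNReal.one_ne_top)
  rw [tsub_zero] at h
  refine tendsto_of_tendsto_of_tendsto_of_le_of_le h tendsto_const_nhds (fun ρ => ?_)
    fun ρ => prob_le_one
  -- Subadditivity over the event and its complement suffices, again without measurability.
  refine tsub_le_iff_right.2 ?_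
  rw [← measure_univ (μ := RandomConnection.sampleLaw ρ)]
  refine (measure_mono fun ω _ => ?_).trans (measure_union_le _ _)
  exact em _
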